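/- Let an instance of the Fault-Tolerant Path problem (FTP) consist of a finite graph $G=(V,E)$ (parallel edges allowed) with nonnegative rational edge weights $w$, two distinct nodes $s,t\in V$, a subset $M\subseteq E$ of faulty edges (the edges in $E\setminus M$ are called secure), and an integer $k\ge 0$. A set $S\subseteq E$ is feasible if $S\setminus F$ contains an $s$-$t$ path for every $F\subseteq M$ with $|F|\le k$; the problem is to find a feasible $S$ of minimum cost $w(S)=\sum_{e\in S}w_e$. Both for directed graphs and for undirected graphs the following holds. There is an algorithm which, on every instance, halts in time polynomial in the size of the instance (the number of nodes plus the number of edges plus the binary lengths of $k$ and of the numerators and denominators of the weights), reports infeasibility if the instance has no feasible solution, and otherwise returns a feasible set $S$ with $w(S)\le (k+1)\,w(S')$ for every feasible $S'\subseteq E$, that is, a $(k+1)$-approximate solution. Moreover, the returned set is the support $S=\{e\in E: z_e\neq 0\}$ of an integral $s$-$t$ flow $z$ of value $k+1$ which has minimum cost $\sum_{e} w_e|z_e|$ among all $s$-$t$ flows of value $k+1$ (fractional ones included) in $G$ with capacity $1$ on every faulty edge and $k+1$ on every secure edge. (In an undirected graph the flow on an edge may go in either direction, the direction being recorded by the sign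 of $z_e$.) -/

import Mathlib

namespace FaultTolerantPath

/-! ## Random access machine with a step count

Programs work on integer variables and on integer arrays, all of unbounded size. -/

/-- The memory of the machine: variables, named by natural numbers, and arrays, named by natural
numbers and indexed by integers. -/
structure Memory where
  var : ℕ → ℤ
  arr : ℕ → ℤ → ℤ

/-- Overwrite a variable. -/
def Memory.setVar (μ : Memory) (x : ℕ) (v : ℤ) : Memory :=
  { μ with var := Function.update μ.var x v }

/-- Overwrite one cell of an array. -/
def Memory.setArr (μ : Memory) (a : ℕ) (i v : ℤ) : Memory :=
  { μ with arr := Function.update μ.arr a (Function.update (μ.arr a) i v) }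

/-- The bit length of an integer (without its sign). -/
def bitLength (v : ℤ) : ℕ := Nat.size v.natAbs

/-- Arithmetic expressions; `get a i` reads cell `i` of the array `a`. -/
inductive Expr : Type
  | lit (c : ℤ)
  | var (x : ℕ)
  | get (a : ℕ) (i : Expr)
  | add (e₁ e₂ : Expr)
  | sub (e₁ e₂ : Expr)
  | mul (e₁ e₂ : Expr)
  | lt (e₁ e₂ : Expr)
  | eq (e₁ e₂ : Expr)

/-- The value of an expression; comparisons return `1` (true) or `0` (false). -/
def Expr.eval (μ : Memory) : Expr → ℤ
  | .lit c => c
  | .var x => μ.var x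
  | .get a i => μ.arr a (i.eval μ)
  | .add e₁ e₂ => e₁.eval μ + e₂.eval μ
  | .sub e₁ e₂ => e₁.eval μ - e₂.eval μ
  | .mul e₁ e₂ => e₁.eval μ * e₂.eval μ
  | .lt e₁ e₂ => if e₁.eval μ < e₂.eval μ then 1 else 0
  | .eq e₁ e₂ => if e₁.eval μ = e₂.eval μ then 1 else 0

/-- The number of steps charged for evaluating an expression. Every operation costs one step, and
a multiplication costs in addition the bit lengths of its two factors. Hence the largest bit length
in memory grows by at most a constant (depending on the program) per charged step, so the machine
is polynomially equivalent to a Turing machine. -/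
def Expr.cost (μ : Memory) : Expr → ℕ
  | .lit _ => 1
  | .var _ => 1
  | .get _ i => 1 + i.cost μ
  | .add e₁ e₂ => 1 + e₁.cost μ + e₂.cost μ
  | .sub e₁ e₂ => 1 + e₁.cost μ + e₂.cost μ
  | .mul e₁ e₂ =>
      1 + bitLength (e₁.eval μ) + bitLength (e₂.eval μ) + e₁.cost μ + e₂.cost μ
  | .lt e₁ e₂ => 1 + e₁.cost μ + e₂.cost μ
  | .eq e₁ e₂ => 1 + e₁.cost μ + e₂.cost μ

/-- Programs. -/
inductive Prog : Type
  | skip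
  /-- `x := e` -/
  | assign (x : ℕ) (e : Expr)
  /-- `a[i] := e` -/
  | store (a : ℕ) (i e : Expr)
  /-- `p; q` -/
  | seq (p q : Prog)
  /-- run `p` if `e ≠ 0`, and `q` otherwise -/
  | branch (e : Expr) (p q : Prog)
  /-- repeat `p` as long as `e ≠ 0` -/
  | loop (e : Expr) (p : Prog)

/-- `Runs p μ T ν`: started on the memory `μ`, the program `p` halts after exactly `T` steps, with
the memory `ν`. -/
inductive Runs : Prog → Memory → ℕ → Memory → Prop
  | skip (μ : Memory) : Runs .skip μ 1 μ
  | assign (x : ℕ) (e : Expr) (μ : Memory) :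
      Runs (.assign x e) μ (1 + e.cost μ) (μ.setVar x (e.eval μ))
  | store (a : ℕ) (i e : Expr) (μ : Memory) :
      Runs (.store a i e) μ (1 + i.cost μ + e.cost μ) (μ.setArr a (i.eval μ) (e.eval μ))
  | seq {p q : Prog} {μ ν ξ : Memory} {T U : ℕ} :
      Runs p μ T ν → Runs q ν U ξ → Runs (.seq p q) μ (T + U) ξ
  | branch_true {e : Expr} {p q : Prog} {μ ν : Memory} {T : ℕ} :
      e.eval μ ≠ 0 → Runs p μ T ν → Runs (.branch e p q) μ (1 + e.cost μ + T) ν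
  | branch_false {e : Expr} {p q : Prog} {μ ν : Memory} {T : ℕ} :
      e.eval μ = 0 → Runs q μ T ν → Runs (.branch e p q) μ (1 + e.cost μ + T) ν
  | loop_done {e : Expr} {p : Prog} {μ : Memory} :
      e.eval μ = 0 → Runs (.loop e p) μ (1 + e.cost μ) μ
  | loop_step {e : Expr} {p : Prog} {μ ν ξ : Memory} {T U : ℕ} :
      e.eval μ ≠ 0 → Runs p μ T ν → Runs (.loop e p) ν U ξ →
      Runs (.loop e p) μ (1 + e.cost μ + T + U) ξ

/-! ## The fault-tolerant path problem -/

/-- Whether the graphs under consideration are directed or undirected. -/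
inductive GraphKind : Type
  | directed
  | undirected

/-- An instance of FTP: a finite (directed or undirected) graph with nodes `0, …, n - 1` and edges
`0, …, m - 1`, parallel edges allowed, with nonnegative rational edge weights `w`, two distinct
nodes `s` and `t`, the set `faulty` of faulty edges and the number `k` of possible faults.
In an undirected graph `tail e` and `head e` are the two ends of `e`, in any order. -/
structure Instance (kind : GraphKind) where
  n : ℕ
  m : ℕ
  tail : Fin m → Fin n
  head : Fin m → Fin n
  w : Fin m → ℚ≥0
  s : Fin n
  t : Fin n
  s_ne_t : s ≠ t
  faulty : Finset (Fin m)
  k : ℕ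

namespace Instance

variable {kind : GraphKind} (I : Instance kind)

/-- One can go from `u` to `v` along an edge of `A`: forwards, or, in an undirected graph, in
either direction. -/
def Step (A : Finset (Fin I.m)) (u v : Fin I.n) : Prop :=
  ∃ e ∈ A, (I.tail e = u ∧ I.head e = v) ∨
    (kind = GraphKind.undirected ∧ I.tail e = v ∧ I.head e = u)

/-- The edge set `A` contains a path from `s` to `t`. -/
def HasPath (A : Finset (Fin I.m)) : Prop :=
  Relation.ReflTransGen (I.Step A) I.s I.t

/-- `S` is a feasible solution: `S \ F` contains an `s`-`t` path for every set `F` of at most `k`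
faulty edges. -/
def Feasible (S : Finset (Fin I.m)) : Prop :=
  ∀ F : Finset (Fin I.m), F ⊆ I.faulty → F.card ≤ I.k → I.HasPath (S \ F)

/-- The total weight of an edge set. -/
def cost (S : Finset (Fin I.m)) : ℚ≥0 := ∑ e ∈ S, I.w e

/-- `S` is feasible and its cost is at most `ρ` times the cost of every feasible solution, hence
at most `ρ` times the optimal cost. -/
def IsApproxSolution (ρ : ℚ≥0) (S : Finset (Fin I.m)) : Prop :=
  I.Feasible S ∧ ∀ S' : Finset (Fin I.m), I.Feasible S' → I.cost S ≤ ρ * I.cost S'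

/-- The edge capacities: `1` on faulty edges and `k + 1` on secure edges. -/
def capacity (e : Fin I.m) : ℝ := if e ∈ I.faulty then 1 else (I.k : ℝ) + 1

/-- The net flow of `z` out of the node `v`. -/
def netOut (z : Fin I.m → ℝ) (v : Fin I.n) : ℝ :=
  (∑ e with I.tail e = v, z e) - ∑ e with I.head e = v, z e

/-- `z` is an `s`-`t` flow of value `k + 1` respecting the capacities. A value `z e > 0` is flow
from `tail e` to `head e`; a value `z e < 0` is flow `|z e|` from `head e` to `tail e`, which is
possible in undirected graphs only. -/
structure IsFlow (z : Fin I.m → ℝ) : Prop where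
  nonneg : kind = GraphKind.directed → ∀ e, 0 ≤ z e
  le_capacity : ∀ e, |z e| ≤ I.capacity e
  conservation : ∀ v, v ≠ I.s → v ≠ I.t → I.netOut z v = 0
  value : I.netOut z I.s = (I.k : ℝ) + 1

/-- The cost of a flow. -/
def flowCost (z : Fin I.m → ℝ) : ℝ := ∑ e, (I.w e : ℝ) * |z e|

/-- `z` is an integral flow of value `k + 1` that has minimum cost among all flows of this value,
fractional ones included. -/
def IsIntegralMinCostFlow (z : Fin I.m → ℤ) : Prop :=
  I.IsFlow (fun e => (z e : ℝ)) ∧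
    ∀ y : Fin I.m → ℝ, I.IsFlow y → I.flowCost (fun e => (z e : ℝ)) ≤ I.flowCost y

/-- The edges that carry flow. -/
def support (z : Fin I.m → ℤ) : Finset (Fin I.m) := {e | z e ≠ 0}

/-! ### Input and output of algorithms -/

/-- The size of an instance: number of nodes, number of edges, and the binary lengths of all the
numbers (with weights as reduced fractions). -/
def size : ℕ :=
  I.n + I.m + Nat.size I.k + ∑ e, (Nat.size (I.w e).num + Nat.size (I.w e).den)

/-- A function on edges as the contents of an array; cells outside `0, …, m - 1` are `0`. -/
def edgeArray (f : Fin I.m → ℤ) (i : ℤ) : ℤ :=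
  if h : 0 ≤ i ∧ i.toNat < I.m then f ⟨i.toNat, h.2⟩ else 0

/-- The initial memory: `n, m, k, s, t` in the variables `0, …, 4`; tails, heads, numerators and
denominators of the weights, and the indicator of the faulty edges in the arrays `0, …, 4`; zeros
everywhere else. -/
def input : Memory where
  var x := match x with
    | 0 => (I.n : ℤ)
    | 1 => (I.m : ℤ)
    | 2 => (I.k : ℤ)
    | 3 => ((I.s : ℕ) : ℤ)
    | 4 => ((I.t : ℕ) : ℤ)
    | _ => 0
  arr a := match a with
    | 0 => I.edgeArray fun e => ((I.tail e : ℕ) : ℤ)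
    | 1 => I.edgeArray fun e => ((I.head e : ℕ) : ℤ)
    | 2 => I.edgeArray fun e => ((I.w e).num : ℤ)
    | 3 => I.edgeArray fun e => ((I.w e).den : ℤ)
    | 4 => I.edgeArray fun e => if e ∈ I.faulty then 1 else 0
    | _ => fun _ => 0

/-- The memory `ν` holds the edge set `S` as output: variable `0` is `1`, and array `0` is the
indicator of `S`. -/
def Returns (ν : Memory) (S : Finset (Fin I.m)) : Prop :=
  ν.var 0 = 1 ∧ ∀ e : Fin I.m, ν.arr 0 ((e : ℕ) : ℤ) = if e ∈ S then 1 else 0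

/-- The memory `ν` holds the output that there is no feasible solution: variable `0` is `0`. -/
def ReportsInfeasible (_I : Instance kind) (ν : Memory) : Prop := ν.var 0 = 0

end Instance

end FaultTolerantPath

/-! The combinatorial core: `S` is feasible exactly when it carries an integral flow of value `k +
1` with at most one unit on each faulty edge. Given such a flow, `k` faults destroy at most `k`
units, so a path survives in its support (`IntFlow.feasible_support`). Conversely, if augmentation
inside `S` gets stuck at a value `j ≤ k`, the faulty edges carrying flow out of the reached set are
at most `j` faults separating `s` from `t` (`IntFlow.not_feasible`, `Feasible.exists_intFlow`). The
flow inside a feasible `S'` puts at most `k + 1` units on each edge, so it costs at most `(k + 1)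
w(S')`; a minimum cost flow costs no more, and its support costs no more than the integral flow
(`IsIntegralMinCostFlow.isApproxSolution`).

Optimality, also against fractional flows, is LP duality: a node potential under which all residual
arcs have nonnegative reduced cost (`Certifies`). The primal-dual method maintains one. It grows a
tree of residual arcs of reduced cost zero from `s`, raising the potential of the unreached nodes by
the least reduced cost leaving the tree (`Certifies.raise`), and then sends one unit along the tree
path to `t` (`IntFlow.push`, `Certifies.push`). If no residual arc leaves the tree, the cut shows
that nothing is feasible.

Since `k` is given in binary, `k + 1` augmentations may be too many. But a flow of value `m + 1`
already has a path of flow-carrying secure edges, and all remaining units fit on it without changing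
the support (`Certifies.extend`); so `min m k + 1` augmentations determine the output. The method is
written in a language `Cmd` of bounded loops, whose running time is polynomial once loop bounds and
factors of products are controlled (`runs_toProg`). Multiplications occur only in clearing the
denominators of the weights. -/

namespace FaultTolerantPath

namespace Instance

variable {kind : GraphKind} (I : Instance kind)

/-! ## Residual arcs, cuts and optimality of flows -/

/-- The net flow of `z` out of the node `v`, as a single sum over all edges. -/
def excess {R : Type*} [CommRing R] (z : Fin I.m → R) (v : Fin I.n) : R :=
  ∑ e, z e * ((if I.tail e = v then 1 else 0) - (if I.head e = v then 1 else 0))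

/-- The net outflow of a unit `s`-`t` flow. -/
def demand (R : Type*) [CommRing R] (v : Fin I.n) : R :=
  (if v = I.s then 1 else 0) - (if v = I.t then 1 else 0)

/-- The first node of an arc; the arc `(e, true)` is the edge `e` traversed forwards,
and `(e, false)` is `e` traversed backwards. -/
def src (a : Fin I.m × Bool) : Fin I.n := if a.2 then I.tail a.1 else I.head a.1

/-- The last node of an arc. -/
def dst (a : Fin I.m × Bool) : Fin I.n := if a.2 then I.head a.1 else I.tail a.1

/-- The sign of the flow along an arc. -/
def sgn (b : Bool) : ℤ := if b then 1 else -1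

/-- The flow of `z` along an arc. -/
def along (z : Fin I.m → ℤ) (a : Fin I.m × Bool) : ℤ := sgn a.2 * z a.1

/-- An integral `s`-`t` flow of value `j` that respects the capacities of the faulty edges and
has at most `j` units on each edge. -/
structure IntFlow (z : Fin I.m → ℤ) (j : ℕ) : Prop where
  nonneg : kind = GraphKind.directed → ∀ e, 0 ≤ z e
  faulty : ∀ e ∈ I.faulty, |z e| ≤ 1
  bound : ∀ e, |z e| ≤ j
  balance : ∀ v, I.excess z v = j * I.demand ℤ v

/-- One more unit can be sent along the arc. -/
def Residual (z : Fin I.m → ℤ) (a : Fin I.m × Bool) : Prop :=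
  I.along z a < 0 ∨ ((a.2 = true ∨ kind = GraphKind.undirected) ∧
    (a.1 ∉ I.faulty ∨ I.along z a < 1))

/-- The cost of sending one more unit along the arc. -/
def arcCost (W : Fin I.m → ℤ) (z : Fin I.m → ℤ) (a : Fin I.m × Bool) : ℤ :=
  if I.along z a < 0 then -W a.1 else W a.1

/-- The reduced cost of an arc with respect to the potential `π`. -/
def redCost (W : Fin I.m → ℤ) (z : Fin I.m → ℤ) (π : Fin I.n → ℤ) (a : Fin I.m × Bool) : ℤ :=
  I.arcCost W z a + π (I.src a) - π (I.dst a)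

/-- The potential `π` certifies that `z` has minimum cost. -/
def Certifies (W : Fin I.m → ℤ) (z : Fin I.m → ℤ) (π : Fin I.n → ℤ) : Prop :=
  ∀ a, I.Residual z a → 0 ≤ I.redCost W z π a

variable {I}

/-! ### Flow balance and cuts. -/

lemma excess_eq_netOut (z : Fin I.m → ℝ) (v : Fin I.n) : I.netOut z v = I.excess z v := by
  simp [netOut, excess, mul_sub, Finset.sum_filter]

lemma excess_add {R : Type*} [CommRing R] (y z : Fin I.m → R) (v : Fin I.n) :
    I.excess (fun e => y e + z e) v = I.excess y v + I.excess z v := by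
  simp [excess, add_mul, Finset.sum_add_distrib]

lemma excess_const_mul {R : Type*} [CommRing R] (c : R) (z : Fin I.m → R) (v : Fin I.n) :
    I.excess (fun e => c * z e) v = c * I.excess z v := by
  simp [excess, mul_assoc, Finset.mul_sum]

lemma excess_cast (z : Fin I.m → ℤ) (v : Fin I.n) :
    I.excess (fun e => (z e : ℝ)) v = (I.excess z v : ℤ) := by
  simp [excess]

/-- Summation by parts. An indicator as `π` gives the flow across a cut, a potential gives the dual
objective, and a constant shows that the excesses sum to zero. -/
lemma sum_mul_excess {R : Type*} [CommRing R] (π : Fin I.n → R) (z : Fin I.m → R) :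
    ∑ v, π v * I.excess z v = ∑ e, z e * (π (I.tail e) - π (I.head e)) := by
  simp only [excess, Finset.mul_sum]
  rw [Finset.sum_comm]
  refine Finset.sum_congr rfl fun e _ => ?_
  simp [mul_sub, mul_comm]

lemma sum_mul_demand {R : Type*} [CommRing R] (π : Fin I.n → R) :
    ∑ v, π v * I.demand R v = π I.s - π I.t := by
  simp [demand, mul_sub]

/-- The excess after sending one unit along an arc. -/
lemma excess_single (a : Fin I.m × Bool) (v : Fin I.n) :
    I.excess (fun e => if e = a.1 then sgn a.2 else 0) v =
      (if v = I.src a then 1 else 0) - (if v = I.dst a then 1 else 0) := by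
  obtain ⟨e, b⟩ := a
  cases b <;> simp [excess, src, dst, sgn, eq_comm]

/-- The flow across a cut is the value of the flow. -/
lemma exists_crossing {z : Fin I.m → ℤ} {j : ℕ} (hz : ∀ v, I.excess z v = j * I.demand ℤ v)
    {X : Set (Fin I.n)} (hs : I.s ∈ X) (ht : I.t ∉ X) :
    ∃ c : Fin I.m → ℤ, (j : ℤ) = ∑ e, c e ∧ ∀ e,
      (c e = 0 ∧ ∀ b, ¬ (I.src (e, b) ∈ X ∧ I.dst (e, b) ∉ X)) ∨
      ∃ b, I.src (e, b) ∈ X ∧ I.dst (e, b) ∉ X ∧ c e = I.along z (e, b) ∧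
        ∀ b', I.src (e, b') ∈ X ∧ I.dst (e, b') ∉ X → b' = b := by
  classical
  have h := sum_mul_excess (I := I) (fun v => if v ∈ X then (1 : ℤ) else 0) z
  simp only [hz] at h
  have h2 := sum_mul_demand (I := I) (fun v => if v ∈ X then (1 : ℤ) else 0)
  simp only [hs, ht, if_true, if_false, sub_zero] at h2
  refine ⟨fun e => z e * ((if I.tail e ∈ X then 1 else 0) - if I.head e ∈ X then 1 else 0),
    ?_, ?_⟩
  · calc (j : ℤ) = j * ∑ v, (if v ∈ X then (1 : ℤ) else 0) * I.demand ℤ v := by rw [h2, mul_one]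
      _ = ∑ v, (if v ∈ X then (1 : ℤ) else 0) * (j * I.demand ℤ v) := by
        rw [Finset.mul_sum]
        exact Finset.sum_congr rfl fun v _ => by ring
      _ = _ := h
  intro e
  by_cases h1 : I.tail e ∈ X <;> by_cases h3 : I.head e ∈ X <;>
    simp [src, dst, along, sgn, h1, h3]

/-- Only crossing edges with positive outward flow contribute positively to the value, and each of
them lies in `F` and contributes at most one. This serves both the feasibility of supports and
`Certifies.extend`. -/
lemma IntFlow.le_card {z : Fin I.m → ℤ} {j : ℕ} (hz : I.IntFlow z j)
    {X : Set (Fin I.n)} (hs : I.s ∈ X) (ht : I.t ∉ X) (F : Finset (Fin I.m))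
    (hF : ∀ a, I.src a ∈ X → I.dst a ∉ X → 0 < I.along z a → a.1 ∈ F ∧ I.along z a ≤ 1) :
    j ≤ F.card := by
  obtain ⟨c, hc, h⟩ := exists_crossing hz.balance hs ht
  have : ∑ e, c e ≤ ∑ e, if e ∈ F then (1 : ℤ) else 0 := by
    refine Finset.sum_le_sum fun e _ => ?_
    rcases h e with h | ⟨b, h1, h2, h3, -⟩
    · rw [h.1]; split_ifs <;> simp
    · rcases lt_or_ge 0 (I.along z (e, b)) with h4 | h4
      · have := hF (e, b) h1 h2 h4
        rw [if_pos this.1, h3]; exact this.2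
      · rw [h3]; split_ifs <;> omega
  simp at this
  omega

/-- If no residual arc on edges of `S` leaves `X`, and the flow has value at most `k`, then `S` is
not feasible. -/
lemma IntFlow.not_feasible {z : Fin I.m → ℤ} {j : ℕ} (hz : I.IntFlow z j) (hj : j ≤ I.k)
    {S : Finset (Fin I.m)} (hS : ∀ e, e ∉ S → z e = 0)
    {X : Set (Fin I.n)} (hs : I.s ∈ X) (ht : I.t ∉ X)
    (hX : ∀ a, I.Residual z a → a.1 ∈ S → I.src a ∈ X → I.dst a ∈ X) : ¬ I.Feasible S := by
  classical
  intro hf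
  obtain ⟨c, hc, h⟩ := exists_crossing hz.balance hs ht
  -- The faults that refute feasibility. Since no edge carries flow back into `X` (`hc0`), there are
  -- at most `j ≤ k` of them.
  let F : Finset (Fin I.m) := {e | e ∈ S ∧ 1 ≤ c e ∧ e ∈ I.faulty}
  have hc0 : ∀ e, 0 ≤ c e := by
    intro e
    rcases h e with h | ⟨b, h1, h2, h3, -⟩
    · exact h.1.ge
    · rw [h3]
      by_cases he : e ∈ S
      · by_contra h4
        exact h2 (hX (e, b) (Or.inl (by omega)) he h1)
      · simp [along, hS e he]
  have hcard : F.card ≤ I.k := by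
    have : ∑ e, (if e ∈ F then (1 : ℤ) else 0) ≤ ∑ e, c e := by
      refine Finset.sum_le_sum fun e _ => ?_
      split_ifs with h
      · simp only [F, Finset.mem_filter] at h; exact h.2.2.1
      · exact hc0 e
    simp at this
    omega
  have hp := hf F (fun e he => by simp only [F, Finset.mem_filter] at he; exact he.2.2.2) hcard
  have key : ∀ v, Relation.ReflTransGen (I.Step (S \ F)) I.s v → v ∈ X := by
    intro v hv
    induction hv with
    | refl => exact hs
    | @tail u v _ huv ih =>
      by_contra hvX
      obtain ⟨e, he, h5⟩ := huv
      rw [Finset.mem_sdiff] at he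
      obtain ⟨b, hb1, hb2, hb3⟩ : ∃ b, I.src (e, b) = u ∧ I.dst (e, b) = v ∧
          (b = true ∨ kind = GraphKind.undirected) := by
        rcases h5 with h5 | h5
        · exact ⟨true, by simp [src, h5], by simp [dst, h5], Or.inl rfl⟩
        · exact ⟨false, by simp [src, h5], by simp [dst, h5], Or.inr h5.1⟩
      -- A step leaving `X` uses a nonresidual arc in a permitted direction, so its edge is faulty
      -- and carries a unit outwards: it belongs to `F`.
      have hres : ¬ I.Residual z (e, b) := fun hr =>
        hvX (hb2 ▸ hX (e, b) hr he.1 (by rw [hb1]; exact ih))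
      simp only [Residual, not_or, not_and, not_lt] at hres
      have h6 := hres.2 hb3
      rcases h e with h7 | ⟨b', _, _, h3, h8⟩
      · exact h7.2 b ⟨by rw [hb1]; exact ih, by rw [hb2]; exact hvX⟩
      · have := h8 b ⟨by rw [hb1]; exact ih, by rw [hb2]; exact hvX⟩
        subst this
        apply he.2
        simp only [F, Finset.mem_filter]
        exact ⟨Finset.mem_univ _, he.1, h3 ▸ h6.2, by simpa using h6.1⟩
  exact ht (key _ hp)

/-! ### Augmentation and integral max-flow min-cut. -/

/-- Sending one unit along residual arcs from `s` to `t` increases the value by one. -/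
lemma IntFlow.push {z y : Fin I.m → ℤ} {j : ℕ} (hz : I.IntFlow z j)
    (hy : ∀ e, y e = z e ∨ ∃ b, I.Residual z (e, b) ∧ y e = z e + sgn b)
    (hb : ∀ v, I.excess y v = I.excess z v + I.demand ℤ v) : I.IntFlow y (j + 1) where
  nonneg hk e := by
    have h0 := hz.nonneg hk e
    rcases hy e with h | ⟨b, hr, h⟩
    · omega
    · subst hk
      cases b <;> simp [Residual, along, sgn] at hr h <;> omega
  faulty e he := by
    have h0 := hz.faulty e he
    rw [abs_le] at h0 ⊢
    rcases hy e with h | ⟨b, hr, h⟩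
    · omega
    · cases b <;> simp [Residual, along, sgn, he] at hr h <;> omega
  -- `Residual` does not enforce the capacity `k + 1` of secure edges; it is respected because no
  -- edge ever carries more than the value of the flow.
  bound e := by
    have h0 := hz.bound e
    rw [abs_le] at h0 ⊢
    rcases hy e with h | ⟨b, hr, h⟩
    · push_cast; omega
    · cases b <;> simp [sgn] at h <;> push_cast <;> omega
  balance v := by rw [hb, hz.balance]; push_cast; ring

/-- Sending flow along arcs of reduced cost zero preserves the certificate. -/
lemma Certifies.push {W : Fin I.m → ℤ} {z y : Fin I.m → ℤ} {π : Fin I.n → ℤ}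
    (hW : ∀ e, 0 ≤ W e) (hz : I.Certifies W z π)
    (hy : ∀ e, y e = z e ∨
      ∃ b, I.Residual z (e, b) ∧ I.redCost W z π (e, b) = 0 ∧ y e = z e + sgn b) :
    I.Certifies W y π := by
  rintro ⟨e, c⟩ hres
  have hWe := hW e
  rcases hy e with h | ⟨b, hr, ht, h⟩
  · have := hz (e, c)
    simp only [Residual, redCost, arcCost, along, h] at this hres ⊢
    exact this hres
  -- The reverse arc gets reduced cost zero as well. When the push cancels opposite flow, the cost
  -- of the arc itself may jump from `-W e` to `W e`, which is an increase because `0 ≤ W e`.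
  · revert ht
    cases b <;> cases c <;>
      simp only [redCost, arcCost, along, h, sgn, src, dst, if_true, if_false, Bool.false_eq_true]
        <;> split_ifs <;> intros <;> omega

/-- Either there is a unit flow from `s` to `t` along arcs of `A`, or there is a cut that no
arc of `A` leaves. -/
lemma exists_unit_flow_or_cut (A : Fin I.m × Bool → Prop) :
    (∃ P : Fin I.m → ℤ, (∀ e, P e = 0 ∨ ∃ b, A (e, b) ∧ P e = sgn b) ∧
      ∀ v, I.excess P v = I.demand ℤ v) ∨
    ∃ X : Set (Fin I.n), I.s ∈ X ∧ I.t ∉ X ∧ ∀ a, A a → I.src a ∈ X → I.dst a ∈ X := by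
  classical
  -- Each node of `X` is reached by a unit flow confined to `X`. On the edge of an arc leaving `X`
  -- that flow vanishes, so the arc can be appended; a maximal `X` therefore has no such arc or
  -- contains `t`.
  let good : Finset (Fin I.n) → Prop := fun X => I.s ∈ X ∧ ∀ u ∈ X, ∃ P : Fin I.m → ℤ,
    (∀ e, P e = 0 ∨ ∃ b, A (e, b) ∧ P e = sgn b) ∧
    (∀ e, P e ≠ 0 → I.tail e ∈ X ∧ I.head e ∈ X) ∧
    ∀ v, I.excess P v = (if v = I.s then 1 else 0) - (if v = u then 1 else 0)
  have h0 : good {I.s} := by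
    refine ⟨by simp, fun u hu => ⟨fun _ => 0, by simp, by simp, fun v => ?_⟩⟩
    rw [Finset.mem_singleton] at hu
    simp [excess, hu]
  obtain ⟨X, hX, hmax⟩ := (Finset.univ.filter good).exists_max_image Finset.card
    ⟨{I.s}, by simpa using h0⟩
  simp only [Finset.mem_filter, Finset.mem_univ, true_and] at hX hmax
  by_cases ht : I.t ∈ X
  · obtain ⟨P, h1, -, h2⟩ := hX.2 I.t ht
    exact Or.inl ⟨P, h1, h2⟩
  · refine Or.inr ⟨X, hX.1, ht, ?_⟩
    rintro ⟨e, b⟩ ha hu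
    by_contra hv
    have hends : I.tail e ∈ insert (I.dst (e, b)) X ∧ I.head e ∈ insert (I.dst (e, b)) X := by
      cases b <;> simp [src, dst] at hu ⊢ <;> exact Or.inr hu
    have : good (insert (I.dst (e, b)) X) := by
      refine ⟨Finset.mem_insert_of_mem hX.1, fun u hu' => ?_⟩
      rcases Finset.mem_insert.1 hu' with rfl | hu'
      · obtain ⟨P, h1, h2, h3⟩ := hX.2 _ hu
        have hPe : P e = 0 := by
          by_contra hne
          have := h2 e hne
          cases b <;> simp [dst] at hv <;> tauto
        refine ⟨fun f => P f + if f = e then sgn b else 0, fun f => ?_, fun f hf => ?_,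
          fun v => ?_⟩
        · by_cases hfe : f = e
          · subst hfe; exact Or.inr ⟨b, ha, by simp [hPe]⟩
          · simpa [hfe] using h1 f
        · by_cases hfe : f = e
          · subst hfe; exact hends
          · have := h2 f (by simpa [hfe] using hf)
            exact ⟨Finset.mem_insert_of_mem this.1, Finset.mem_insert_of_mem this.2⟩
        · rw [excess_add, h3, excess_single (e, b)]; ring
      · obtain ⟨P, h1, h2, h3⟩ := hX.2 u hu'
        exact ⟨P, h1, fun f hf => ⟨Finset.mem_insert_of_mem (h2 f hf).1,
          Finset.mem_insert_of_mem (h2 f hf).2⟩, h3⟩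
    have := hmax _ this
    rw [Finset.card_insert_of_notMem (by simpa using hv)] at this
    omega

/-- The integral maximum flow minimum cut theorem for a feasible solution. -/
lemma Feasible.exists_intFlow {S : Finset (Fin I.m)} (hS : I.Feasible S) (j : ℕ)
    (hj : j ≤ I.k + 1) : ∃ z, I.IntFlow z j ∧ ∀ e, e ∉ S → z e = 0 := by
  induction j with
  | zero => exact ⟨fun _ => 0, ⟨by simp, by simp, by simp, by simp [excess]⟩, by simp⟩
  | succ j ih =>
    obtain ⟨z, hz, hzS⟩ := ih (by omega)
    rcases exists_unit_flow_or_cut (I := I) (fun a => I.Residual z a ∧ a.1 ∈ S) with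
      ⟨P, h1, h2⟩ | ⟨X, hs, ht, hX⟩
    · refine ⟨fun e => z e + P e, hz.push (fun e => ?_) fun v => by rw [excess_add, h2],
        fun e he => ?_⟩
      · rcases h1 e with h | ⟨b, h, h'⟩
        · simp [h]
        · exact Or.inr ⟨b, h.1, by rw [h']⟩
      · rcases h1 e with h | ⟨b, h, h'⟩
        · simp [h, hzS e he]
        · exact absurd h.2 he
    · exact absurd hS (hz.not_feasible (by omega) hzS hs ht fun a h h' => hX a ⟨h, h'⟩)

/-! ### Potentials certify optimality among fractional flows. -/

lemma IntFlow.isFlow {z : Fin I.m → ℤ} (hz : I.IntFlow z (I.k + 1)) :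
    I.IsFlow (fun e => (z e : ℝ)) where
  nonneg hk e := by exact_mod_cast hz.nonneg hk e
  le_capacity e := by
    unfold capacity
    split_ifs with h
    · exact_mod_cast hz.faulty e h
    · exact_mod_cast hz.bound e
  conservation v hs ht := by
    rw [excess_eq_netOut, excess_cast, hz.balance]; simp [demand, hs, ht]
  value := by
    rw [excess_eq_netOut, excess_cast, hz.balance]; simp [demand, I.s_ne_t]

/-- `IsFlow` is silent about the balance at `t`; it is forced because all excesses sum to zero. -/
lemma IsFlow.excess_eq {y : Fin I.m → ℝ} (hy : I.IsFlow y) (v : Fin I.n) :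
    I.excess y v = (I.k + 1) * I.demand ℝ v := by
  have hs := hy.value
  rw [excess_eq_netOut] at hs
  by_cases h1 : v = I.s
  · subst h1; simp [demand, I.s_ne_t, hs]
  by_cases h2 : v = I.t
  · have h := sum_mul_excess (I := I) (fun _ => (1 : ℝ)) y
    simp only [one_mul, sub_self, mul_zero, Finset.sum_const_zero] at h
    rw [← Finset.add_sum_erase _ _ (Finset.mem_univ I.s),
      ← Finset.add_sum_erase _ _ (Finset.mem_erase.2 ⟨I.s_ne_t.symm, Finset.mem_univ I.t⟩),
      Finset.sum_eq_zero, hs] at h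
    · subst h2; simp [demand, I.s_ne_t.symm]; linarith
    · intro u hu
      simp only [Finset.mem_erase] at hu
      rw [← excess_eq_netOut]; exact hy.conservation u hu.2.1 hu.1
  · rw [← excess_eq_netOut, hy.conservation v h1 h2]; simp [demand, h1, h2]

/-- A certified flow minimizes the reduced cost of every single edge. -/
lemma Certifies.edge_le {W : Fin I.m → ℤ} {z : Fin I.m → ℤ} {π : Fin I.n → ℤ}
    (hW : ∀ e, 0 ≤ W e) (hz : I.IntFlow z (I.k + 1)) (hc : I.Certifies W z π)
    {y : Fin I.m → ℝ} (hy : I.IsFlow y) (e : Fin I.m) :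
    (W e : ℝ) * |(z e : ℝ)| + z e * (π (I.tail e) - π (I.head e) : ℝ) ≤
      W e * |y e| + y e * (π (I.tail e) - π (I.head e) : ℝ) := by
  have hf := hc (e, true)
  have hb := hc (e, false)
  have hWe : (0 : ℝ) ≤ W e := by exact_mod_cast hW e
  obtain ⟨D, hD⟩ : ∃ D : ℤ, D = π (I.tail e) - π (I.head e) := ⟨_, rfl⟩
  have hD' : (π (I.tail e) - π (I.head e) : ℝ) = D := by rw [hD]; push_cast; ring
  have hcap := hy.le_capacity e
  simp only [capacity] at hcap
  simp only [Residual, redCost, arcCost, along, sgn, src, dst, if_true, if_false, one_mul,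
    Bool.false_eq_true, true_or, true_and, false_or, neg_mul, Left.neg_neg_iff] at hf hb
  rw [hD']
  have hya := abs_nonneg (y e)
  have hy1 := le_abs_self (y e)
  have hy2 := neg_abs_le (y e)
  -- The function `y ↦ W e * |y| + y * D` has slopes `D - W e` and `D + W e` on the two sides of
  -- `0`. The residual arcs of `e` give these slopes the signs that make `z e` a minimizer.
  rcases lt_trichotomy (z e) 0 with h | h | h
  · have hk : kind = GraphKind.undirected := by
      cases hkd : kind with
      | undirected => rfl
      | directed => exact absurd (hz.nonneg hkd e) (by omega)
    have h1 := hf (Or.inl h)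
    rw [if_pos h] at h1
    have h1' : (W e : ℝ) ≤ D := by exact_mod_cast (by omega : W e ≤ D)
    rw [abs_of_neg (by exact_mod_cast h)]
    by_cases hfa : e ∈ I.faulty
    · have h2 : z e = -1 := by have := abs_le.1 (hz.faulty e hfa); omega
      rw [if_pos hfa] at hcap
      rw [h2]; push_cast
      nlinarith [mul_nonneg (sub_nonneg.2 h1') (by linarith : 0 ≤ y e + 1)]
    -- A secure edge with flow is residual in both directions, so the slope on the side of `z e` is
    -- zero.
    · have h2 := hb (Or.inr ⟨hk, Or.inl hfa⟩)
      rw [if_neg (by omega)] at h2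
      have h2' : (W e : ℝ) = D := by exact_mod_cast (by omega : W e = D)
      rw [← h2']
      nlinarith
  · have h1 := hf (Or.inr (Or.inr (by omega)))
    rw [if_neg (by omega)] at h1
    have h1' : -(W e : ℝ) ≤ D := by exact_mod_cast (by omega : -W e ≤ D)
    rw [h]
    simp only [Int.cast_zero, abs_zero, mul_zero, zero_mul, add_zero]
    rcases le_total 0 (y e) with h3 | h3
    · rw [abs_of_nonneg h3]; nlinarith
    · rw [abs_of_nonpos h3]
      cases hkd : kind with
      | directed =>
        have : y e = 0 := le_antisymm h3 (hy.nonneg hkd e)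
        simp [this]
      | undirected =>
        have h2 := hb (Or.inr ⟨hkd, Or.inr (by omega)⟩)
        rw [if_neg (by omega)] at h2
        have h2' : (D : ℝ) ≤ W e := by exact_mod_cast (by omega : D ≤ W e)
        nlinarith
  · have h1 := hb (Or.inl h)
    rw [if_pos h] at h1
    have h1' : (D : ℝ) ≤ -W e := by exact_mod_cast (by omega : D ≤ -W e)
    rw [abs_of_pos (by exact_mod_cast h)]
    by_cases hfa : e ∈ I.faulty
    · have h2 : z e = 1 := by have := abs_le.1 (hz.faulty e hfa); omega
      rw [if_pos hfa] at hcap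
      rw [h2]; push_cast
      nlinarith [mul_nonneg (sub_nonneg.2 h1') (by linarith : 0 ≤ 1 - y e)]
    · have h2 := hf (Or.inr (Or.inl hfa))
      rw [if_neg (by omega)] at h2
      have h2' : (D : ℝ) = -W e := by exact_mod_cast (by omega : D = -W e)
      rw [h2']
      nlinarith

/-- A certified integral flow of value `k + 1` is a minimum cost flow. -/
lemma Certifies.isIntegralMinCostFlow {W : Fin I.m → ℤ} {z : Fin I.m → ℤ} {π : Fin I.n → ℤ}
    {L : ℕ} (hL : 0 < L) (hW : ∀ e, (W e : ℚ) = L * (I.w e : ℚ))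
    (hz : I.IntFlow z (I.k + 1)) (hc : I.Certifies W z π) : I.IsIntegralMinCostFlow z := by
  refine ⟨hz.isFlow, fun y hy => ?_⟩
  have hW0 : ∀ e, 0 ≤ W e := fun e => by
    have : (0 : ℚ) ≤ W e := by rw [hW]; positivity
    exact_mod_cast this
  have hWr : ∀ e, (W e : ℝ) = L * (I.w e : ℝ) := fun e => by
    have := congrArg (fun q : ℚ => (q : ℝ)) (hW e)
    push_cast at this
    exact this
  have h := Finset.sum_le_sum fun e (_ : e ∈ Finset.univ) => hc.edge_le hW0 hz hy e
  -- The potential term depends only on the value of the flow, so it cancels between `z` and `y`.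
  have hex : ∀ {x : Fin I.m → ℝ}, I.IsFlow x →
      ∑ e, x e * ((π (I.tail e) : ℝ) - π (I.head e)) = (I.k + 1) * ((π I.s : ℝ) - π I.t) := by
    intro x hx
    rw [← sum_mul_excess (fun v => (π v : ℝ)) x, ← sum_mul_demand (fun v => (π v : ℝ)),
      Finset.mul_sum]
    exact Finset.sum_congr rfl fun v _ => by rw [hx.excess_eq]; ring
  rw [Finset.sum_add_distrib, Finset.sum_add_distrib, hex hz.isFlow, hex hy] at h
  have hcost : ∀ x : Fin I.m → ℝ, ∑ e, (W e : ℝ) * |x e| = L * I.flowCost x := by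
    intro x
    simp only [flowCost, Finset.mul_sum, hWr, mul_assoc]
  rw [hcost y, hcost (fun e => (z e : ℝ))] at h
  exact le_of_mul_le_mul_left (by linarith) (by exact_mod_cast hL : (0 : ℝ) < L)

/-! ### From flows to approximate solutions. -/

/-- The support of an integral flow of value `k + 1` is feasible. -/
lemma IntFlow.feasible_support {z : Fin I.m → ℤ} (hz : I.IntFlow z (I.k + 1)) :
    I.Feasible (I.support z) := by
  intro F hF hcard
  by_contra ht
  -- Cut at the nodes reachable in the surviving support: positive flow leaves only through `F`, one
  -- unit per edge, so `k + 1 ≤ F.card ≤ k`.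
  have := hz.le_card (X := {v | Relation.ReflTransGen (I.Step (I.support z \ F)) I.s v})
    Relation.ReflTransGen.refl ht F ?_
  · omega
  rintro ⟨e, b⟩ hu hv hpos
  have he : e ∈ F := by
    by_contra he
    refine hv (Relation.ReflTransGen.tail hu ⟨e, ?_, ?_⟩)
    · simp only [support, Finset.mem_sdiff, Finset.mem_filter, Finset.mem_univ, true_and]
      refine ⟨fun h => ?_, he⟩
      simp [along, h] at hpos
    · cases b
      · refine Or.inr ⟨?_, by simp [dst, src]⟩
        cases hkd : kind with
        | undirected => rfl
        | directed =>
          have := hz.nonneg hkd e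
          simp [along, sgn] at hpos
          omega
      · exact Or.inl ⟨by simp [src], by simp [dst]⟩
  refine ⟨he, ?_⟩
  have := abs_le.1 (hz.faulty e (hF he))
  cases b <;> simp [along, sgn] <;> omega

/-- The support of an integral minimum cost flow is a `(k + 1)`-approximate solution. -/
lemma IsIntegralMinCostFlow.isApproxSolution {z : Fin I.m → ℤ} (hz : I.IntFlow z (I.k + 1))
    (hmin : I.IsIntegralMinCostFlow z) :
    I.IsApproxSolution ((I.k : ℚ≥0) + 1) (I.support z) := by
  refine ⟨hz.feasible_support, fun S hS => ?_⟩
  obtain ⟨y, hy, hyS⟩ := hS.exists_intFlow (I.k + 1) le_rfl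
  have h := hmin.2 _ hy.isFlow
  have h1 : ((I.cost (I.support z) : ℚ≥0) : ℝ) ≤ I.flowCost (fun e => (z e : ℝ)) := by
    simp only [cost, flowCost, NNRat.cast_sum]
    refine (Finset.sum_le_sum fun e he => ?_).trans
      (Finset.sum_le_sum_of_subset_of_nonneg (Finset.subset_univ _) fun e _ _ => by positivity)
    simp only [support, Finset.mem_filter, Finset.mem_univ, true_and] at he
    -- Integrality enters here: a nonzero flow is at least one unit.
    have : (1 : ℝ) ≤ |(z e : ℝ)| := by exact_mod_cast Int.one_le_abs he
    exact le_mul_of_one_le_right (by positivity) this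
  have h2 : I.flowCost (fun e => (y e : ℝ)) ≤ (I.k + 1) * ((I.cost S : ℚ≥0) : ℝ) := by
    simp only [cost, flowCost, NNRat.cast_sum, Finset.mul_sum]
    rw [← Finset.sum_subset (Finset.subset_univ S)]
    · refine Finset.sum_le_sum fun e _ => ?_
      rw [mul_comm]
      refine mul_le_mul_of_nonneg_right ?_ (by positivity)
      exact_mod_cast hy.bound e
    · intro e _ he
      simp [hyS e he]
  have h3 := h1.trans (h.trans h2)
  exact_mod_cast h3

/-! ### Large `k`: sending many units at once. -/

/-- Given a certified flow of value `m + 1 ≤ k + 1`, the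
remaining `k - m` units can be sent along secure edges that carry flow already. -/
lemma Certifies.extend {W : Fin I.m → ℤ} {z : Fin I.m → ℤ} {π : Fin I.n → ℤ}
    (hm : I.m ≤ I.k) (hz : I.IntFlow z (I.m + 1)) (hc : I.Certifies W z π) :
    ∃ y, I.IntFlow y (I.k + 1) ∧ I.Certifies W y π ∧ I.support y = I.support z := by
  -- Look for a path of secure edges in the direction of their flow. Adding `δ = k - m` units there
  -- preserves the sign of the flow on each edge, hence the support.
  rcases exists_unit_flow_or_cut (I := I) (fun a => a.1 ∉ I.faulty ∧ 0 < I.along z a) with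
    ⟨P, h1, h2⟩ | ⟨X, hs, ht, hX⟩
  · obtain ⟨δ, hδ⟩ : ∃ δ : ℕ, I.k = I.m + δ := ⟨I.k - I.m, by omega⟩
    have hcase : ∀ e, z e + δ * P e = z e ∨ (e ∉ I.faulty ∧ ∃ b, 0 < sgn b * z e ∧
        z e + δ * P e = z e + δ * sgn b) := by
      intro e
      rcases h1 e with h | ⟨b, h, h'⟩
      · simp [h]
      · exact Or.inr ⟨h.1, b, h.2, by rw [h']⟩
    refine ⟨fun e => z e + δ * P e, ⟨fun hk e => ?_, fun e he => ?_, fun e => ?_, fun v => ?_⟩,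
      ?_, ?_⟩
    · have h0 := hz.nonneg hk e
      rcases hcase e with h | ⟨-, b, hb, h⟩
      · simp only [h, h0]
      · cases b <;> simp [sgn] at hb h <;> simp only [h] <;> omega
    · rcases hcase e with h | ⟨hs, -⟩
      · simp only [h]; exact hz.faulty e he
      · exact absurd he hs
    · have h0 := abs_le.1 (hz.bound e)
      push_cast at h0
      rw [abs_le, hδ]
      rcases hcase e with h | ⟨-, b, hb, h⟩
      · simp only [h]; push_cast; omega
      · cases b <;> simp [sgn] at hb h <;> simp only [h] <;> push_cast <;> omega
    · rw [excess_add, excess_const_mul, h2, hz.balance, hδ]; push_cast; ring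
    · rintro ⟨e, c⟩ hres
      have hz' := hc (e, c)
      simp only [Residual, redCost, arcCost, along] at hres hz' ⊢
      rcases hcase e with h | ⟨hs, b, hb, h⟩
      · simp only [h] at hres ⊢; exact hz' hres
      · simp only [h] at hres ⊢
        -- With unchanged signs the arc costs stay the same, and an arc of a secure edge that is
        -- residual now was residual before.
        have hiff : sgn c * (z e + δ * sgn b) < 0 ↔ sgn c * z e < 0 := by
          cases b <;> cases c <;> simp [sgn] at hb ⊢ <;> omega
        simp only [hiff] at hres ⊢
        refine hz' (hres.imp_right fun h => ⟨h.1, Or.inl hs⟩)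
    · ext e
      simp only [support, Finset.mem_filter, Finset.mem_univ, true_and]
      rcases hcase e with h | ⟨-, b, hb, h⟩
      · rw [h]
      · rw [h]; cases b <;> simp [sgn] at hb ⊢ <;> omega
  -- Otherwise some cut is crossed outwards only by faulty edges with at most one unit each, so `m +
  -- 1 ≤ I.faulty.card ≤ m`.
  · exfalso
    have h := hz.le_card hs ht I.faulty fun a hu hv hpos => ?_
    · have := Finset.card_le_univ I.faulty
      simp at this
      omega
    · have hfa : a.1 ∈ I.faulty := by
        by_contra hfa
        exact hv (hX a ⟨hfa, hpos⟩ hu)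
      refine ⟨hfa, ?_⟩
      have := abs_le.1 (hz.faulty a.1 hfa)
      obtain ⟨e, b⟩ := a
      cases b <;> simp [along, sgn] at this ⊢ <;> omega

end Instance

/-! ## Programs with bounded loops -/

@[simp] lemma Memory.setVar_var (μ : Memory) (x y : ℕ) (v : ℤ) :
    (μ.setVar x v).var y = if y = x then v else μ.var y := by
  simp [setVar, Function.update_apply]

@[simp] lemma Memory.setVar_arr (μ : Memory) (x : ℕ) (v : ℤ) : (μ.setVar x v).arr = μ.arr := rfl

@[simp] lemma Memory.setArr_var (μ : Memory) (a : ℕ) (i v : ℤ) : (μ.setArr a i v).var = μ.var := rfl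

@[simp] lemma Memory.setArr_arr (μ : Memory) (a b : ℕ) (i j v : ℤ) :
    (μ.setArr a i v).arr b j = if b = a ∧ j = i then v else μ.arr b j := by
  by_cases h : b = a
  · subst h
    simp [setArr, Function.update_apply]
  · simp [setArr, h]

/-- The number of operations in an expression. -/
def Expr.size : Expr → ℕ
  | .lit _ => 1
  | .var _ => 1
  | .get _ i => 1 + i.size
  | .add e₁ e₂ => 1 + e₁.size + e₂.size
  | .sub e₁ e₂ => 1 + e₁.size + e₂.size
  | .mul e₁ e₂ => 1 + e₁.size + e₂.size
  | .lt e₁ e₂ => 1 + e₁.size + e₂.size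
  | .eq e₁ e₂ => 1 + e₁.size + e₂.size

/-- The expression contains no multiplication. -/
def Expr.mulFree : Expr → Bool
  | .lit _ => true
  | .var _ => true
  | .get _ i => i.mulFree
  | .add e₁ e₂ => e₁.mulFree && e₂.mulFree
  | .sub e₁ e₂ => e₁.mulFree && e₂.mulFree
  | .mul _ _ => false
  | .lt e₁ e₂ => e₁.mulFree && e₂.mulFree
  | .eq e₁ e₂ => e₁.mulFree && e₂.mulFree

/-- All factors of multiplications have bit length at most `β`. -/
def Expr.Tame (β : ℕ) (μ : Memory) : Expr → Prop
  | .lit _ => True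
  | .var _ => True
  | .get _ i => i.Tame β μ
  | .add e₁ e₂ => e₁.Tame β μ ∧ e₂.Tame β μ
  | .sub e₁ e₂ => e₁.Tame β μ ∧ e₂.Tame β μ
  | .mul e₁ e₂ => (bitLength (e₁.eval μ) ≤ β ∧ bitLength (e₂.eval μ) ≤ β) ∧
      e₁.Tame β μ ∧ e₂.Tame β μ
  | .lt e₁ e₂ => e₁.Tame β μ ∧ e₂.Tame β μ
  | .eq e₁ e₂ => e₁.Tame β μ ∧ e₂.Tame β μ

lemma Expr.tame_of_mulFree {e : Expr} (h : e.mulFree = true) (β : ℕ) (μ : Memory) :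
    e.Tame β μ := by
  induction e <;> simp_all [Expr.mulFree, Expr.Tame]

lemma Expr.cost_le {e : Expr} {β : ℕ} {μ : Memory} (h : e.Tame β μ) :
    e.cost μ ≤ e.size * (2 * β + 1) := by
  induction e with
  | lit | var => simp [Expr.cost, Expr.size]
  | get a i ih => have := ih h; simp only [Expr.cost, Expr.size]; nlinarith
  | add e₁ e₂ ih₁ ih₂ | sub e₁ e₂ ih₁ ih₂ | lt e₁ e₂ ih₁ ih₂ | eq e₁ e₂ ih₁ ih₂ =>
    have := ih₁ h.1; have := ih₂ h.2; simp only [Expr.cost, Expr.size]; nlinarith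
  | mul e₁ e₂ ih₁ ih₂ =>
    have := ih₁ h.2.1; have := ih₂ h.2.2; have := h.1.1; have := h.1.2
    simp only [Expr.cost, Expr.size]; nlinarith

/-- Programs whose only loops are `for i = 0, …, b - 1` with a variable `b`. -/
inductive Cmd : Type
  | assign (x : ℕ) (e : Expr)
  | store (a : ℕ) (i e : Expr)
  | seq (c d : Cmd)
  | ite (e : Expr) (c d : Cmd)
  | loop (i b : ℕ) (c : Cmd)

namespace Cmd

/-- The translation to the machine. -/
def toProg : Cmd → Prog
  | assign x e => .assign x e
  | store a i e => .store a i e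
  | seq c d => .seq c.toProg d.toProg
  | ite e c d => .branch e c.toProg d.toProg
  | loop i b c => .seq (.assign i (.lit 0)) (.loop (.lt (.var i) (.var b))
      (.seq c.toProg (.assign i (.add (.var i) (.lit 1)))))

/-- The memory after the execution. -/
def exec : Cmd → Memory → Memory
  | assign x e, μ => μ.setVar x (e.eval μ)
  | store a i e, μ => μ.setArr a (i.eval μ) (e.eval μ)
  | seq c d, μ => d.exec (c.exec μ)
  | ite e c d, μ => if e.eval μ ≠ 0 then c.exec μ else d.exec μ
  | loop i b c, μ => (fun ν => (c.exec ν).setVar i ((c.exec ν).var i + 1))^[(μ.var b).toNat]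
      (μ.setVar i 0)

/-- The variables a program writes. -/
def vars : Cmd → List ℕ
  | assign x _ => [x]
  | store _ _ _ => []
  | seq c d => c.vars ++ d.vars
  | ite _ c d => c.vars ++ d.vars
  | loop i _ c => i :: c.vars

/-- The arrays a program writes. -/
def arrs : Cmd → List ℕ
  | assign _ _ => []
  | store a _ _ => [a]
  | seq c d => c.arrs ++ d.arrs
  | ite _ c d => c.arrs ++ d.arrs
  | loop _ _ c => c.arrs

/-- The variables that bound the loops of a program. -/
def bounds : Cmd → List ℕ
  | assign _ _ => []
  | store _ _ _ => []
  | seq c d => c.bounds ++ d.bounds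
  | ite _ c d => c.bounds ++ d.bounds
  | loop _ b c => b :: c.bounds

/-- Loop bodies change neither their counter nor their bound. -/
def wf : Cmd → Bool
  | assign _ _ => true
  | store _ _ _ => true
  | seq c d => c.wf && d.wf
  | ite _ c d => c.wf && d.wf
  | loop i b c => c.wf && decide (i ∉ c.vars ∧ b ∉ c.vars ∧ i ≠ b)

/-- The program contains no multiplication. -/
def mulFree : Cmd → Bool
  | assign _ e => e.mulFree
  | store _ i e => i.mulFree && e.mulFree
  | seq c d => c.mulFree && d.mulFree
  | ite e c d => e.mulFree && (c.mulFree && d.mulFree)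
  | loop _ _ c => c.mulFree

/-- The nesting depth of the loops. -/
def depth : Cmd → ℕ
  | assign _ _ => 0
  | store _ _ _ => 0
  | seq c d => max c.depth d.depth
  | ite _ c d => max c.depth d.depth
  | loop _ _ c => c.depth + 1

/-- The length of the program. -/
def length : Cmd → ℕ
  | assign _ e => 1 + e.size
  | store _ i e => 1 + i.size + e.size
  | seq c d => c.length + d.length
  | ite e c d => 1 + e.size + (c.length + d.length)
  | loop _ _ c => 14 + c.length

/-- In the execution started on the given memory, all loops are bounded by `B`, and all factors
of multiplications have bit length at most `β`. -/
def Tame (β B : ℕ) : Cmd → Memory → Prop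
  | assign _ e, μ => e.Tame β μ
  | store _ i e, μ => i.Tame β μ ∧ e.Tame β μ
  | seq c d, μ => c.Tame β B μ ∧ d.Tame β B (c.exec μ)
  | ite e c d, μ => e.Tame β μ ∧ (e.eval μ ≠ 0 → c.Tame β B μ) ∧ (e.eval μ = 0 → d.Tame β B μ)
  | loop i b c, μ => (μ.var b).toNat ≤ B ∧ ∀ j < (μ.var b).toNat,
      c.Tame β B ((fun ν => (c.exec ν).setVar i ((c.exec ν).var i + 1))^[j] (μ.setVar i 0))

/-- Frame rule. With `exec_arr` it turns preservation of memory into a membership check that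
`decide` settles for concrete programs. -/
lemma exec_var {c : Cmd} {x : ℕ} (h : x ∉ c.vars) (μ : Memory) : (c.exec μ).var x = μ.var x := by
  induction c generalizing μ with
  | assign y e => simp [vars] at h; simp [exec, h]
  | store a i e => simp [exec]
  | seq c d ihc ihd =>
    simp [vars] at h; simp [exec, ihc h.1, ihd h.2]
  | ite e c d ihc ihd =>
    simp [vars] at h; simp only [exec]; split_ifs <;> simp [ihc h.1, ihd h.2]
  | loop i b c ih =>
    simp [vars] at h
    simp only [exec]
    generalize (μ.var b).toNat = N
    induction N with
    | zero => simp [h.1]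
    | succ N ihN => rw [Function.iterate_succ_apply']; simp [h.1, ih h.2, ihN]

lemma exec_arr {c : Cmd} {a : ℕ} (h : a ∉ c.arrs) (μ : Memory) : (c.exec μ).arr a = μ.arr a := by
  induction c generalizing μ with
  | assign y e => simp [exec]
  | store b i e => simp [arrs] at h; simp [exec, Memory.setArr, h]
  | seq c d ihc ihd =>
    simp [arrs] at h; simp [exec, ihc h.1, ihd h.2]
  | ite e c d ihc ihd =>
    simp [arrs] at h; simp only [exec]; split_ifs <;> simp [ihc h.1, ihd h.2]
  | loop i b c ih =>
    simp [arrs] at h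
    simp only [exec]
    generalize (μ.var b).toNat = N
    induction N with
    | zero => simp
    | succ N ihN => rw [Function.iterate_succ_apply']; simp [ih h, ihN]

section Loop

variable {i b : ℕ} {c : Cmd}

lemma iterate_var_counter (hi : i ∉ c.vars) (μ : Memory) (j : ℕ) :
    ((fun ν => (c.exec ν).setVar i ((c.exec ν).var i + 1))^[j] (μ.setVar i 0)).var i = j := by
  induction j with
  | zero => simp
  | succ j ih => rw [Function.iterate_succ_apply', Memory.setVar_var, if_pos rfl, exec_var hi, ih]; simp

lemma iterate_var_bound (hb : b ∉ c.vars) (hib : i ≠ b) (μ : Memory) (j : ℕ) :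
    ((fun ν => (c.exec ν).setVar i ((c.exec ν).var i + 1))^[j] (μ.setVar i 0)).var b =
      μ.var b := by
  induction j with
  | zero => simp [hib.symm]
  | succ j ih => rw [Function.iterate_succ_apply']; simp [hib.symm, exec_var hb, ih]

/-- The invariant rule for intermediate states of a loop. -/
lemma iterate_induction (hwf : (loop i b c).wf = true) (Inv : ℕ → Memory → Prop) {μ : Memory}
    {N : ℕ} (hN : μ.var b = N) (h0 : Inv 0 (μ.setVar i 0))
    (hstep : ∀ j < N, ∀ ν, ν.var i = (j : ℤ) → ν.var b = (N : ℤ) → Inv j ν →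
      Inv (j + 1) ((c.exec ν).setVar i (j + 1))) (j : ℕ) (hj : j ≤ N) :
    Inv j ((fun ν => (c.exec ν).setVar i ((c.exec ν).var i + 1))^[j] (μ.setVar i 0)) := by
  simp only [wf, Bool.and_eq_true, decide_eq_true_eq] at hwf
  induction j with
  | zero => exact h0
  | succ j ih =>
    have hj1 := iterate_var_counter hwf.2.1 μ j
    have := hstep j (by omega) _ hj1
      (by rw [iterate_var_bound hwf.2.2.1 hwf.2.2.2, hN]) (ih (by omega))
    rw [Function.iterate_succ_apply']
    rwa [exec_var hwf.2.1, hj1]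

/-- The invariant rule for loops. -/
lemma loop_induction (hwf : (loop i b c).wf = true) (Inv : ℕ → Memory → Prop) {μ : Memory}
    {N : ℕ} (hN : μ.var b = N) (h0 : Inv 0 (μ.setVar i 0))
    (hstep : ∀ j < N, ∀ ν, ν.var i = (j : ℤ) → ν.var b = (N : ℤ) → Inv j ν →
      Inv (j + 1) ((c.exec ν).setVar i (j + 1))) : Inv N ((loop i b c).exec μ) := by
  have := iterate_induction hwf Inv hN h0 hstep N le_rfl
  simpa [exec, hN] using this

lemma tame_loop (hwf : (loop i b c).wf = true) (Inv : ℕ → Memory → Prop) {β B : ℕ} {μ : Memory}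
    {N : ℕ} (hN : μ.var b = N) (hB : N ≤ B) (h0 : Inv 0 (μ.setVar i 0))
    (hstep : ∀ j < N, ∀ ν, ν.var i = (j : ℤ) → ν.var b = (N : ℤ) → Inv j ν →
      Inv (j + 1) ((c.exec ν).setVar i (j + 1)))
    (htame : ∀ j < N, ∀ ν, ν.var i = (j : ℤ) → ν.var b = (N : ℤ) → Inv j ν → c.Tame β B ν) :
    (loop i b c).Tame β B μ := by
  have hwf' := hwf
  simp only [wf, Bool.and_eq_true, decide_eq_true_eq] at hwf'
  refine ⟨by simpa [hN] using hB, fun j hj => ?_⟩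
  simp only [hN, Int.toNat_natCast] at hj
  exact htame j hj _ (iterate_var_counter hwf'.2.1 μ j)
    (by rw [iterate_var_bound hwf'.2.2.1 hwf'.2.2.2, hN])
    (iterate_induction hwf Inv hN h0 hstep j hj.le)

end Loop

/-- The bounding variables are never written, so their initial values bound every loop at any depth.
-/
lemma tame_of_mulFree {c : Cmd} (hc : c.mulFree = true) {β B : ℕ} {μ : Memory}
    (hB : ∀ b ∈ c.bounds, b ∉ c.vars ∧ (μ.var b).toNat ≤ B) : c.Tame β B μ := by
  induction c generalizing μ with
  | assign x e => exact Expr.tame_of_mulFree hc β μ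
  | store a i e =>
    simp only [mulFree, Bool.and_eq_true] at hc
    exact ⟨Expr.tame_of_mulFree hc.1 β μ, Expr.tame_of_mulFree hc.2 β μ⟩
  | seq c d ihc ihd =>
    simp only [mulFree, Bool.and_eq_true, bounds, vars, List.mem_append, not_or] at hc hB
    refine ⟨ihc hc.1 fun b hb => ?_, ihd hc.2 fun b hb => ?_⟩
    · have := hB b (Or.inl hb); exact ⟨this.1.1, this.2⟩
    · have := hB b (Or.inr hb); rw [exec_var this.1.1]; exact ⟨this.1.2, this.2⟩
  | ite e c d ihc ihd =>
    simp only [mulFree, Bool.and_eq_true, bounds, vars, List.mem_append, not_or] at hc hB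
    refine ⟨Expr.tame_of_mulFree hc.1 β μ, fun _ => ihc hc.2.1 fun b hb => ?_,
      fun _ => ihd hc.2.2 fun b hb => ?_⟩
    · have := hB b (Or.inl hb); exact ⟨this.1.1, this.2⟩
    · have := hB b (Or.inr hb); exact ⟨this.1.2, this.2⟩
  | loop i b c ih =>
    simp only [mulFree, bounds, vars, List.mem_cons, not_or] at hc hB
    refine ⟨(hB b (Or.inl rfl)).2, fun j _ => ih hc fun b' hb' => ?_⟩
    have := hB b' (Or.inr hb')
    rw [iterate_var_bound this.1.2 (Ne.symm this.1.1)]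
    exact ⟨this.1.2, this.2⟩

/-- The running time is polynomial in the bounds on loops and on factors of multiplications. -/
theorem runs_toProg {c : Cmd} (hwf : c.wf = true) {β B : ℕ} {μ : Memory} (h : c.Tame β B μ) :
    ∃ T, T ≤ c.length * (2 * β + 1) * (B + 1) ^ c.depth ∧ Runs c.toProg μ T (c.exec μ) := by
  induction c generalizing μ with
  | assign x e =>
    refine ⟨_, ?_, Runs.assign x e μ⟩
    have := Expr.cost_le h
    simp only [length, depth, pow_zero]; nlinarith
  | store a i e =>
    refine ⟨_, ?_, Runs.store a i e μ⟩
    have := Expr.cost_le h.1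
    have := Expr.cost_le h.2
    simp only [length, depth, pow_zero]; nlinarith
  | seq c d ihc ihd =>
    simp only [wf, Bool.and_eq_true] at hwf
    obtain ⟨T, hT, hr⟩ := ihc hwf.1 h.1
    obtain ⟨U, hU, hr'⟩ := ihd hwf.2 h.2
    refine ⟨_, ?_, hr.seq hr'⟩
    have h1 : (B + 1) ^ c.depth ≤ (B + 1) ^ (max c.depth d.depth) :=
      Nat.pow_le_pow_right (by omega) (le_max_left _ _)
    have h2 : (B + 1) ^ d.depth ≤ (B + 1) ^ (max c.depth d.depth) :=
      Nat.pow_le_pow_right (by omega) (le_max_right _ _)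
    calc T + U ≤ c.length * (2 * β + 1) * (B + 1) ^ (max c.depth d.depth) +
        d.length * (2 * β + 1) * (B + 1) ^ (max c.depth d.depth) :=
          Nat.add_le_add (hT.trans (Nat.mul_le_mul_left _ h1)) (hU.trans (Nat.mul_le_mul_left _ h2))
      _ = _ := by simp only [length, depth]; ring
  | ite e c d ihc ihd =>
    simp only [wf, Bool.and_eq_true] at hwf
    have he := Expr.cost_le h.1
    have h1 : (B + 1) ^ c.depth ≤ (B + 1) ^ (max c.depth d.depth) :=
      Nat.pow_le_pow_right (by omega) (le_max_left _ _)
    have h2 : (B + 1) ^ d.depth ≤ (B + 1) ^ (max c.depth d.depth) :=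
      Nat.pow_le_pow_right (by omega) (le_max_right _ _)
    have h3 : 1 ≤ (B + 1) ^ (max c.depth d.depth) := Nat.one_le_pow _ _ (by omega)
    have h4 : 1 + e.cost μ ≤ (1 + e.size) * (2 * β + 1) * (B + 1) ^ (max c.depth d.depth) :=
      (by nlinarith : 1 + e.cost μ ≤ (1 + e.size) * (2 * β + 1)).trans
        (Nat.le_mul_of_pos_right _ h3)
    by_cases hz : e.eval μ = 0
    · obtain ⟨T, hT, hr⟩ := ihd hwf.2 (h.2.2 hz)
      simp only [exec, hz, ne_eq, not_true_eq_false, if_false]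
      refine ⟨_, ?_, Runs.branch_false hz hr⟩
      have h5 := hT.trans (Nat.mul_le_mul_left _ h2)
      simp only [length, depth]
      calc _ ≤ _ := Nat.add_le_add h4 h5
        _ ≤ _ := by rw [← add_mul, ← add_mul]; gcongr; omega
    · obtain ⟨T, hT, hr⟩ := ihc hwf.1 (h.2.1 hz)
      simp only [exec, hz, ne_eq, not_false_eq_true, if_true]
      refine ⟨_, ?_, Runs.branch_true hz hr⟩
      have h5 := hT.trans (Nat.mul_le_mul_left _ h1)
      simp only [length, depth]
      calc _ ≤ _ := Nat.add_le_add h4 h5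
        _ ≤ _ := by rw [← add_mul, ← add_mul]; gcongr; omega
  | loop i b c ih =>
    simp only [wf, Bool.and_eq_true, decide_eq_true_eq] at hwf
    obtain ⟨hwf, hi, hb, hib⟩ := hwf
    obtain ⟨hN, ht⟩ := h
    let f : Memory → Memory := fun ν => (c.exec ν).setVar i ((c.exec ν).var i + 1)
    set N := (μ.var b).toNat with hNdef
    set D := c.length * (2 * β + 1) * (B + 1) ^ c.depth with hD
    -- A test costs 4 steps and an increment 4, giving 8 per round and 4 for the final test. With 2
    -- steps of initialization, this overhead is covered by the 14 in `length`.
    have key : ∀ r j, j + r = N → ∃ T, T ≤ 4 + r * (8 + D) ∧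
        Runs (.loop (.lt (.var i) (.var b)) (.seq c.toProg (.assign i (.add (.var i) (.lit 1)))))
          (f^[j] (μ.setVar i 0)) T (f^[N] (μ.setVar i 0)) := by
      intro r
      induction r with
      | zero =>
        intro j hj
        refine ⟨4, by omega, ?_⟩
        have hj' : j = N := by omega
        subst hj'
        refine Runs.loop_done (e := .lt (.var i) (.var b)) ?_
        have h1 : (f^[N] (μ.setVar i 0)).var i = _ := iterate_var_counter hi μ N
        have h2 : (f^[N] (μ.setVar i 0)).var b = _ := iterate_var_bound hb hib μ N
        simp only [Expr.eval, h1, h2]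
        split_ifs
        · omega
        · rfl
      | succ r ihr =>
        intro j hj
        obtain ⟨T, hT, hr⟩ := ih hwf (ht j (by omega))
        obtain ⟨U, hU, hr'⟩ := ihr (j + 1) (by omega)
        rw [Function.iterate_succ_apply'] at hr'
        refine ⟨_, ?_, Runs.loop_step ?_ (hr.seq (Runs.assign i (.add (.var i) (.lit 1)) _)) hr'⟩
        · simp only [Expr.cost]
          nlinarith
        · have h1 : (f^[j] (μ.setVar i 0)).var i = _ := iterate_var_counter hi μ j
          have h2 : (f^[j] (μ.setVar i 0)).var b = _ := iterate_var_bound hb hib μ j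
          simp only [Expr.eval, h1, h2]
          split_ifs
          · exact one_ne_zero
          · omega
    obtain ⟨T, hT, hr⟩ := key N 0 (by omega)
    refine ⟨_, ?_, (Runs.assign i (.lit 0) μ).seq hr⟩
    have h1 : 1 ≤ (2 * β + 1) * (B + 1) ^ c.depth :=
      Nat.one_le_iff_ne_zero.2 (by positivity)
    simp only [length, depth, Expr.cost]
    calc 1 + 1 + T ≤ 6 + B * (8 + D) := by
          have := Nat.mul_le_mul_right (8 + D) hN
          omega
      _ ≤ (14 + D) * (B + 1) := by nlinarith
      _ ≤ (14 * ((2 * β + 1) * (B + 1) ^ c.depth) + D) * (B + 1) := by gcongr; omega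
      _ = _ := by rw [hD]; ring

end Cmd

/-! ## The algorithm

Variables `0, …, 4` hold the input, `5` the number of augmentations and `6` the failure flag.
Arrays `0, …, 4` hold the input, `5` the integral weights, `6` the flow, `7` the potential, `8` the
stamps of the reached nodes (positive if reached), and `9, 10, 11` the edge, the direction and the
first node of the arc through which a node was reached. -/

namespace Program

open FaultTolerantPath.Expr FaultTolerantPath.Cmd

/-- Do nothing. -/
def skip : Cmd := assign 29 (lit 0)

/-- Is the current arc residual? Here `10` is its edge, `19` the flow along it, and `20` tells
whether its direction is allowed. -/
def isResidual : Expr :=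
  -- Truth values are added: `0 <` a sum codes a disjunction, `1 <` a conjunction of two, and `2 <`
  -- in `isCrossing` a conjunction of three.
  lt (lit 0) (add (lt (var 19) (lit 0)) (lt (lit 1) (add (var 20)
    (lt (lit 0) (add (eq (get 4 (var 10)) (lit 0)) (lt (var 19) (lit 1)))))))

/-- Does the current arc, from `17` to `18`, leave the set of reached nodes? -/
def isCrossing : Expr :=
  lt (lit 2) (add isResidual (add (lt (lit 0) (get 8 (var 17))) (lt (get 8 (var 18)) (lit 1))))

/-- Compute the reduced cost of the current arc. -/
def reducedCost : Cmd :=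
  seq (ite (lt (var 19) (lit 0)) (assign 21 (sub (lit 0) (get 5 (var 10))))
      (assign 21 (get 5 (var 10))))
    (assign 21 (sub (add (var 21) (get 7 (var 17))) (get 7 (var 18))))

/-- Make the current arc the best one. -/
def record : Cmd :=
  seq (assign 11 (lit 1)) (seq (assign 12 (var 21)) (seq (assign 13 (var 10))
    (seq (assign 14 (var 28)) (seq (assign 15 (var 17)) (assign 16 (var 18))))))

/-- Compare the current arc with the best one. -/
def scanArc : Cmd :=
  seq reducedCost (ite isCrossing
    (ite (lt (lit 0) (add (eq (var 11) (lit 0)) (lt (var 21) (var 12)))) record skip) skip)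

/-- Set the current arc. -/
def setArc (u v x a d : Expr) : Cmd :=
  seq (assign 17 u) (seq (assign 18 v) (seq (assign 19 x) (seq (assign 20 a) (assign 28 d))))

/-- Set the current arc to the forward direction of the current edge. -/
def setForward : Cmd :=
  setArc (get 0 (var 10)) (get 1 (var 10)) (get 6 (var 10)) (lit 1) (lit 1)

/-- Set the current arc to the backward direction of the current edge. -/
def setBackward (kind : GraphKind) : Cmd :=
  setArc (get 1 (var 10)) (get 0 (var 10)) (sub (lit 0) (get 6 (var 10)))
    (match kind with
      | .directed => lit 0
      | .undirected => lit 1) (lit (-1))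

/-- Scan both directions of the current edge. -/
def scanEdge (kind : GraphKind) : Cmd :=
  seq (seq setForward scanArc) (seq (setBackward kind) scanArc)

/-- Find the arc of minimum reduced cost that leaves the set of reached nodes. -/
def scan (kind : GraphKind) : Cmd := seq (assign 11 (lit 0)) (loop 10 1 (scanEdge kind))

/-- Raise the potential of the nodes not reached. -/
def raise : Cmd :=
  loop 9 0 (ite (lt (get 8 (var 9)) (lit 1)) (store 7 (var 9) (add (get 7 (var 9)) (var 12))) skip)

/-- Reach a new node through the best arc. -/
def extend : Cmd :=
  seq (store 8 (var 16) (add (var 8) (lit 2))) (seq (store 9 (var 16) (var 13))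
    (seq (store 10 (var 16) (var 14)) (store 11 (var 16) (var 15))))

/-- One round of the search for an augmenting path. -/
def searchRound (kind : GraphKind) : Cmd :=
  ite (var 6) skip (ite (lt (lit 0) (get 8 (var 4))) skip
    (seq (scan kind) (ite (var 11) (seq raise extend) (assign 6 (lit 1)))))

/-- Search for an augmenting path. -/
def search (kind : GraphKind) : Cmd :=
  seq (loop 9 0 (store 8 (var 9) (lit 0))) (seq (store 8 (var 3) (lit 1)) (loop 8 0 (searchRound kind)))

/-- Send one unit through the arc that leads to the current node. -/
def back : Cmd :=
  ite (eq (var 22) (var 3)) skip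
    (seq (store 6 (get 9 (var 22)) (add (get 6 (get 9 (var 22))) (get 10 (var 22))))
      (assign 22 (get 11 (var 22))))

/-- Send one unit along the augmenting path. -/
def augment : Cmd := seq (assign 22 (var 4)) (loop 23 0 back)

/-- Increase the value of the flow by one. -/
def iteration (kind : GraphKind) : Cmd :=
  ite (var 6) skip (seq (search kind) (ite (var 6) skip augment))

/-- Multiply the numerator of an edge by the denominators of the other edges. -/
def multiply : Cmd :=
  loop 25 1 (ite (eq (var 24) (var 25)) skip (assign 26 (mul (var 26) (get 3 (var 25)))))

/-- Compute the integral weights. -/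
def weights : Cmd :=
  loop 24 1 (seq (assign 26 (get 2 (var 24))) (seq multiply (store 5 (var 24) (var 26))))

/-- Compute the number of augmentations. -/
def setValue : Cmd :=
  ite (lt (var 1) (var 2)) (assign 5 (add (var 1) (lit 1))) (assign 5 (add (var 2) (lit 1)))

/-- Write the output. -/
def output : Cmd :=
  -- The tails in array `0` are no longer needed. Comparing twice with `0` yields the indicator of
  -- nonzero flow.
  seq (loop 27 1 (store 0 (var 27) (eq (eq (get 6 (var 27)) (lit 0)) (lit 0))))
    (assign 0 (eq (var 6) (lit 0)))

/-- The part of the algorithm without multiplications. -/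
def flow (kind : GraphKind) : Cmd :=
  seq (loop 7 5 (iteration kind)) output

/-- The algorithm. -/
def algorithm (kind : GraphKind) : Cmd := seq weights (seq setValue (flow kind))

end Program

open Program

/-! ### Correspondence between memory and instance. -/

variable {kind : GraphKind} {I : Instance kind}

/-- The values of an array on the edges. -/
def Memory.edges (I : Instance kind) (ν : Memory) (a : ℕ) (e : Fin I.m) : ℤ :=
  ν.arr a ((e : ℕ) : ℤ)

/-- The values of an array on the nodes. -/
def Memory.nodes (I : Instance kind) (ν : Memory) (a : ℕ) (v : Fin I.n) : ℤ :=
  ν.arr a ((v : ℕ) : ℤ)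

/-- The memory holds the instance, with weights `W`. -/
structure Holds (I : Instance kind) (W : Fin I.m → ℤ) (ν : Memory) : Prop where
  n : ν.var 0 = I.n
  m : ν.var 1 = I.m
  s : ν.var 3 = ((I.s : ℕ) : ℤ)
  t : ν.var 4 = ((I.t : ℕ) : ℤ)
  tail : ∀ e : Fin I.m, ν.arr 0 ((e : ℕ) : ℤ) = ((I.tail e : ℕ) : ℤ)
  head : ∀ e : Fin I.m, ν.arr 1 ((e : ℕ) : ℤ) = ((I.head e : ℕ) : ℤ)
  faulty : ∀ e : Fin I.m, ν.arr 4 ((e : ℕ) : ℤ) = if e ∈ I.faulty then 1 else 0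
  W : ∀ e : Fin I.m, ν.arr 5 ((e : ℕ) : ℤ) = W e

lemma Holds.congr {W : Fin I.m → ℤ} {μ ν : Memory} (h : Holds I W μ)
    (hv : ∀ x ∈ [0, 1, 3, 4], ν.var x = μ.var x) (ha : ∀ a ∈ [0, 1, 4, 5], ν.arr a = μ.arr a) :
    Holds I W ν := by
  simp only [List.mem_cons, List.not_mem_nil, or_false, forall_eq_or_imp, forall_eq] at hv ha
  obtain ⟨h0, h1, h3, h4⟩ := hv
  obtain ⟨a0, a1, a4, a5⟩ := ha
  exact ⟨h0 ▸ h.n, h1 ▸ h.m, h3 ▸ h.s, h4 ▸ h.t, a0 ▸ h.tail, a1 ▸ h.head, a4 ▸ h.faulty,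
    a5 ▸ h.W⟩

lemma Holds.exec {W : Fin I.m → ℤ} {μ : Memory} (h : Holds I W μ) {c : Cmd}
    (hv : ∀ x ∈ [0, 1, 3, 4], x ∉ c.vars) (ha : ∀ a ∈ [0, 1, 4, 5], a ∉ c.arrs) :
    Holds I W (c.exec μ) :=
  h.congr (fun x hx => Cmd.exec_var (hv x hx) μ) (fun a hx => Cmd.exec_arr (ha a hx) μ)

lemma Holds.setVar {W : Fin I.m → ℤ} {μ : Memory} (h : Holds I W μ) {x : ℕ} {v : ℤ}
    (hx : x ∉ [0, 1, 3, 4]) : Holds I W (μ.setVar x v) :=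
  h.congr (fun y hy => by
    rw [Memory.setVar_var, if_neg]; rintro rfl; exact hx hy) (fun a _ => rfl)

/-! ### Scanning arcs -/

/-- The arc is residual and leaves the set of nodes with positive stamp. -/
def Crossing (I : Instance kind) (z : Fin I.m → ℤ) (stamp : Fin I.n → ℤ) (a : Fin I.m × Bool) :
    Prop :=
  I.Residual z a ∧ 0 < stamp (I.src a) ∧ stamp (I.dst a) < 1

/-- The memory holds the best crossing arc among those in `A`. -/
def Best (I : Instance kind) (W z : Fin I.m → ℤ) (π stamp : Fin I.n → ℤ)
    (A : Fin I.m × Bool → Prop) (ν : Memory) : Prop :=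
  (ν.var 11 = 0 ∧ ∀ a, A a → ¬ Crossing I z stamp a) ∨
  (ν.var 11 ≠ 0 ∧ ∃ a, Crossing I z stamp a ∧ ν.var 12 = I.redCost W z π a ∧
    ν.var 13 = ((a.1 : ℕ) : ℤ) ∧ ν.var 14 = Instance.sgn a.2 ∧
    ν.var 15 = ((I.src a : ℕ) : ℤ) ∧ ν.var 16 = ((I.dst a : ℕ) : ℤ) ∧
    ∀ a', A a' → Crossing I z stamp a' → I.redCost W z π a ≤ I.redCost W z π a')

/-- The variables describe the current arc. -/
structure Current (I : Instance kind) (z : Fin I.m → ℤ) (a : Fin I.m × Bool) (ν : Memory) :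
    Prop where
  edge : ν.var 10 = ((a.1 : ℕ) : ℤ)
  src : ν.var 17 = ((I.src a : ℕ) : ℤ)
  dst : ν.var 18 = ((I.dst a : ℕ) : ℤ)
  along : ν.var 19 = I.along z a
  allowed : (a.2 = true ∨ kind = GraphKind.undirected) ∧ ν.var 20 = 1 ∨
    ¬ (a.2 = true ∨ kind = GraphKind.undirected) ∧ ν.var 20 = 0
  dir : ν.var 28 = Instance.sgn a.2

variable {W z : Fin I.m → ℤ} {π stamp : Fin I.n → ℤ}

lemma isResidual_eval {ν : Memory} {a : Fin I.m × Bool} (hI : Holds I W ν)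
    (ha : Current I z a ν) :
    I.Residual z a ∧ isResidual.eval ν = 1 ∨ ¬ I.Residual z a ∧ isResidual.eval ν = 0 := by
  simp only [isResidual, Expr.eval, ha.along, ha.edge, hI.faulty, Instance.Residual]
  by_cases h1 : I.along z a < 0
  · rcases ha.allowed with h2 | h2 <;> left <;> refine ⟨Or.inl h1, ?_⟩ <;>
      simp only [h1, if_true] <;> split_ifs <;> omega
  · rcases ha.allowed with h2 | h2 <;> by_cases h3 : a.1 ∈ I.faulty <;>
      by_cases h4 : I.along z a < 1 <;> simp [h1, h2, h3, h4]

lemma isCrossing_eval {ν : Memory} {a : Fin I.m × Bool} (hI : Holds I W ν)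
    (ha : Current I z a ν) (hs : ν.nodes I 8 = stamp) :
    isCrossing.eval ν ≠ 0 ↔ Crossing I z stamp a := by
  subst hs
  simp only [isCrossing, Expr.eval, ha.src, ha.dst, Crossing, Memory.nodes]
  rcases isResidual_eval hI ha with ⟨h, h'⟩ | ⟨h, h'⟩ <;> rw [h'] <;> simp only [h] <;>
    split_ifs <;> simp_all

lemma reducedCost_exec {ν : Memory} {a : Fin I.m × Bool} (hI : Holds I W ν)
    (ha : Current I z a ν) (hp : ν.nodes I 7 = π) :
    (reducedCost.exec ν).var 21 = I.redCost W z π a := by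
  subst hp
  simp only [reducedCost, Cmd.exec, Expr.eval, ha.along, ha.edge, hI.W,
    Instance.redCost, Instance.arcCost, Memory.nodes]
  split_ifs <;> simp_all [ha.src, ha.dst]

lemma Best.congr {A : Fin I.m × Bool → Prop} {μ ν : Memory} (h : Best I W z π stamp A μ)
    (hv : ∀ x ∈ [11, 12, 13, 14, 15, 16], ν.var x = μ.var x) : Best I W z π stamp A ν := by
  simp only [List.mem_cons, List.not_mem_nil, or_false, forall_eq_or_imp, forall_eq] at hv
  obtain ⟨h1, h2, h3, h4, h5, h6⟩ := hv
  simpa only [Best, h1, h2, h3, h4, h5, h6] using h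

lemma Current.congr {a : Fin I.m × Bool} {μ ν : Memory} (h : Current I z a μ)
    (hv : ∀ x ∈ [10, 17, 18, 19, 20, 28], ν.var x = μ.var x) : Current I z a ν := by
  simp only [List.mem_cons, List.not_mem_nil, or_false, forall_eq_or_imp, forall_eq] at hv
  obtain ⟨h1, h2, h3, h4, h5, h6⟩ := hv
  exact ⟨h1 ▸ h.edge, h2 ▸ h.src, h3 ▸ h.dst, h4 ▸ h.along, h5 ▸ h.allowed, h6 ▸ h.dir⟩

lemma scanArc_exec {ν : Memory} {a : Fin I.m × Bool} {A : Fin I.m × Bool → Prop}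
    (hI : Holds I W ν) (ha : Current I z a ν) (hp : ν.nodes I 7 = π) (hs : ν.nodes I 8 = stamp)
    (hb : Best I W z π stamp A ν) :
    Best I W z π stamp (fun b => A b ∨ b = a) (scanArc.exec ν) := by
  have hc := reducedCost_exec hI ha hp
  have hv : ∀ x, x ≠ 21 → (reducedCost.exec ν).var x = ν.var x := fun x hx =>
    Cmd.exec_var (by simp [reducedCost, Cmd.vars, hx]) ν
  have ha' : Current I z a (reducedCost.exec ν) :=
    ha.congr fun x hx => hv x (by rintro rfl; revert hx; decide)
  have hb' : Best I W z π stamp A (reducedCost.exec ν) :=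
    hb.congr fun x hx => hv x (by rintro rfl; revert hx; decide)
  have hs' : (reducedCost.exec ν).nodes I 8 = stamp := by
    rw [← hs]; funext v; simp only [Memory.nodes]; rw [Cmd.exec_arr (by decide)]
  have hX := isCrossing_eval (hI.exec (c := reducedCost) (by decide) (by decide)) ha' hs'
  simp only [scanArc, Cmd.exec]
  generalize reducedCost.exec ν = μ at *
  have hskip : Best I W z π stamp A (skip.exec μ) :=
    hb'.congr fun x hx => Cmd.exec_var (by revert x hx; decide) μ
  split_ifs with h1 h2
  · rw [hX] at h1
    right
    refine ⟨by simp [record, Cmd.exec, Expr.eval], a, h1, ?_⟩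
    simp only [record, Cmd.exec, Expr.eval, Memory.setVar_var]
    refine ⟨by simpa using hc, by simpa using ha'.edge, by simpa using ha'.dir,
      by simpa using ha'.src, by simpa using ha'.dst, ?_⟩
    rintro a' (h3 | rfl) h4
    · rcases hb' with h5 | ⟨h5, b, -, h6, -, -, -, -, h7⟩
      · exact absurd h4 (h5.2 a' h3)
      · have := h7 a' h3 h4
        simp only [Expr.eval, h5, hc, h6, if_false] at h2
        split_ifs at h2 <;> omega
    · exact le_rfl
  · rcases hskip with h5 | ⟨h5, b, h8, h6, h9, h10, h11, h12, h7⟩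
    · rw [Cmd.exec_var (by decide)] at h5
      simp [Expr.eval, h5.1] at h2
      split_ifs at h2 <;> omega
    · refine Or.inr ⟨h5, b, h8, h6, h9, h10, h11, h12, ?_⟩
      rintro a' (h3 | rfl) h4
      · exact h7 a' h3 h4
      · rw [Cmd.exec_var (by decide)] at h5 h6
        simp only [Expr.eval, h5, hc, h6, if_false] at h2
        split_ifs at h2 <;> omega
  · rw [hX] at h1
    rcases hskip with h5 | ⟨h5, b, h8, h6, h9, h10, h11, h12, h7⟩
    · refine Or.inl ⟨h5.1, ?_⟩
      rintro a' (h3 | rfl)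
      · exact h5.2 a' h3
      · exact h1
    · refine Or.inr ⟨h5, b, h8, h6, h9, h10, h11, h12, ?_⟩
      rintro a' (h3 | rfl) h4
      · exact h7 a' h3 h4
      · exact absurd h4 h1

lemma setForward_exec {ν : Memory} {e : Fin I.m} (hI : Holds I W ν)
    (he : ν.var 10 = ((e : ℕ) : ℤ)) (hz : ν.edges I 6 = z) :
    Current I z (e, true) (setForward.exec ν) := by
  subst hz
  constructor <;> simp [setForward, setArc, Cmd.exec, Expr.eval, he, hI.tail, hI.head,
    Instance.src, Instance.dst, Instance.along, Instance.sgn, Memory.edges]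

lemma setBackward_exec {ν : Memory} {e : Fin I.m} (hI : Holds I W ν)
    (he : ν.var 10 = ((e : ℕ) : ℤ)) (hz : ν.edges I 6 = z) :
    Current I z (e, false) ((setBackward kind).exec ν) := by
  subst hz
  constructor <;> cases kind <;>
    simp [setBackward, setArc, Cmd.exec, Expr.eval, he, hI.tail, hI.head,
    Instance.src, Instance.dst, Instance.along, Instance.sgn, Memory.edges]

/-- The parts of the memory that the search for the best arc depends on. -/
structure Reads (I : Instance kind) (W z : Fin I.m → ℤ) (π stamp : Fin I.n → ℤ) (ν : Memory) :
    Prop where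
  holds : Holds I W ν
  z : ν.edges I 6 = z
  π : ν.nodes I 7 = π
  stamp : ν.nodes I 8 = stamp

lemma Reads.exec {μ : Memory} (h : Reads I W z π stamp μ) {c : Cmd}
    (hv : ∀ x ∈ [0, 1, 3, 4], x ∉ c.vars) (ha : ∀ a ∈ [0, 1, 4, 5, 6, 7, 8], a ∉ c.arrs) :
    Reads I W z π stamp (c.exec μ) where
  holds := h.holds.exec hv fun a ha' => ha a (by
    revert a; decide)
  z := by rw [← h.z]; funext e; simp only [Memory.edges]; rw [Cmd.exec_arr (ha 6 (by decide))]
  π := by rw [← h.π]; funext e; simp only [Memory.nodes]; rw [Cmd.exec_arr (ha 7 (by decide))]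
  stamp := by
    rw [← h.stamp]; funext e; simp only [Memory.nodes]; rw [Cmd.exec_arr (ha 8 (by decide))]

lemma Reads.setVar {μ : Memory} (h : Reads I W z π stamp μ) {x : ℕ} {v : ℤ}
    (hx : x ∉ [0, 1, 3, 4]) : Reads I W z π stamp (μ.setVar x v) :=
  ⟨h.holds.setVar hx, h.z, h.π, h.stamp⟩

lemma scanEdge_exec {ν : Memory} {e : Fin I.m} {A : Fin I.m × Bool → Prop}
    (h : Reads I W z π stamp ν) (he : ν.var 10 = ((e : ℕ) : ℤ)) (hb : Best I W z π stamp A ν) :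
    Best I W z π stamp (fun a => A a ∨ a.1 = e) ((scanEdge kind).exec ν) := by
  have h1 : Reads I W z π stamp (setForward.exec ν) := h.exec (by decide) (by decide)
  have hb1 : Best I W z π stamp A (setForward.exec ν) :=
    hb.congr fun x hx => Cmd.exec_var (by revert x hx; decide) ν
  have hb2 := scanArc_exec h1.holds (setForward_exec h.holds he h.z) h1.π h1.stamp hb1
  have h2 : Reads I W z π stamp (scanArc.exec (setForward.exec ν)) :=
    h1.exec (by decide) (by decide)
  have he2 : (scanArc.exec (setForward.exec ν)).var 10 = ((e : ℕ) : ℤ) := by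
    rw [Cmd.exec_var (by decide), Cmd.exec_var (by decide), he]
  simp only [scanEdge, Cmd.exec]
  generalize scanArc.exec (setForward.exec ν) = μ at *
  have h3 : Reads I W z π stamp ((setBackward kind).exec μ) :=
    h2.exec (by cases kind <;> decide) (by cases kind <;> decide)
  have hb3 : Best I W z π stamp _ ((setBackward kind).exec μ) :=
    hb2.congr fun x hx => Cmd.exec_var (by revert x hx; cases kind <;> decide) μ
  have hb4 := scanArc_exec h3.holds (setBackward_exec h2.holds he2 h2.z) h3.π h3.stamp hb3
  convert hb4 using 2 with a
  obtain ⟨f, b⟩ := a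
  cases b <;> simp

lemma scan_exec {ν : Memory} (h : Reads I W z π stamp ν) :
    Best I W z π stamp (fun _ => True) ((scan kind).exec ν) := by
  have h1 : Reads I W z π stamp (ν.setVar 11 0) := h.setVar (by decide)
  have := Cmd.loop_induction (i := 10) (b := 1) (c := scanEdge kind) (by cases kind <;> decide)
    (fun j μ => Reads I W z π stamp μ ∧ Best I W z π stamp (fun a => (a.1 : ℕ) < j) μ)
    (μ := ν.setVar 11 0) (N := I.m) h1.holds.m ⟨h1.setVar (by decide), Or.inl (by simp)⟩ ?_
  · simpa [scan, Cmd.exec, Expr.eval] using this.2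
  · rintro j hj μ hi - ⟨hr, hb⟩
    refine ⟨(hr.exec (c := scanEdge kind) (by cases kind <;> decide)
      (by cases kind <;> decide)).setVar (by decide), ?_⟩
    have := scanEdge_exec (e := ⟨j, hj⟩) hr hi hb
    refine Best.congr (μ := (scanEdge kind).exec μ) ?_ fun x hx => ?_
    · convert this using 2 with a
      rw [Fin.ext_iff, Nat.lt_succ_iff_lt_or_eq]
    · rw [Memory.setVar_var, if_neg]
      rintro rfl; revert hx; decide

/-! ### Searching for an augmenting path -/

/-- The nodes with positive stamp form a tree of residual arcs of reduced cost zero. -/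
structure Tree (I : Instance kind) (W z : Fin I.m → ℤ) (π stamp pE pD pN : Fin I.n → ℤ) (B : ℤ) :
    Prop where
  start : stamp I.s = 1
  le : ∀ v, stamp v ≤ B
  parent : ∀ v, v ≠ I.s → 0 < stamp v → ∃ a, I.dst a = v ∧ 0 < stamp (I.src a) ∧
    stamp (I.src a) < stamp v ∧ I.Residual z a ∧ I.redCost W z π a = 0 ∧
    pE v = ((a.1 : ℕ) : ℤ) ∧ pD v = Instance.sgn a.2 ∧ pN v = ((I.src a : ℕ) : ℤ)

/-- Raising the unreached side lowers the reduced cost only of crossing arcs, and by the minimum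
over these; arcs in the opposite direction gain and all others are unchanged. -/
lemma Certifies.raise (hc : I.Certifies W z π) {a : Fin I.m × Bool} (ha : Crossing I z stamp a)
    (hmin : ∀ b, Crossing I z stamp b → I.redCost W z π a ≤ I.redCost W z π b) :
    I.Certifies W z (fun v => if stamp v < 1 then π v + I.redCost W z π a else π v) := by
  intro b hb
  have h0 := hc a ha.1
  have h1 := hc b hb
  have h2 := hmin b
  simp only [Crossing, hb, true_and] at h2
  generalize I.redCost W z π a = D at *
  simp only [Instance.redCost] at h1 h2 ⊢
  split_ifs <;> omega

/-- Old tree arcs join nodes whose potential is fixed, while the new arc loses exactly its own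
reduced cost. The stamp `r + 2` exceeds all earlier ones, so parents keep smaller stamps than
children. -/
lemma Tree.extend {pE pD pN : Fin I.n → ℤ} {r : ℕ} (hT : Tree I W z π stamp pE pD pN (r + 1))
    {a : Fin I.m × Bool} (ha : Crossing I z stamp a) :
    Tree I W z (fun v => if stamp v < 1 then π v + I.redCost W z π a else π v)
      (fun v => if v = I.dst a then (r : ℤ) + 2 else stamp v)
      (fun v => if v = I.dst a then ((a.1 : ℕ) : ℤ) else pE v)
      (fun v => if v = I.dst a then Instance.sgn a.2 else pD v)
      (fun v => if v = I.dst a then ((I.src a : ℕ) : ℤ) else pN v) (r + 2) := by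
  obtain ⟨hr, hu, hv⟩ := ha
  refine ⟨?_, fun v => ?_, fun v hvs hpos => ?_⟩
  · have := hT.start
    rw [if_neg (by rintro h; rw [h] at this; omega), this]
  · have := hT.le v
    split_ifs <;> omega
  · by_cases h : v = I.dst a
    · subst h
      have hne : I.src a ≠ I.dst a := fun h => by rw [h] at hu; omega
      have := hT.le (I.src a)
      refine ⟨a, rfl, ?_, ?_, hr, ?_, by simp, by simp, by simp⟩
      · simpa [hne] using hu
      · simp only [hne, if_false, if_true]; omega
      · simp only [Instance.redCost]; split_ifs <;> omega
    · simp only [h, if_false] at hpos ⊢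
      obtain ⟨b, hb1, hb2, hb3, hb4, hb5, hb6⟩ := hT.parent v hvs hpos
      have hne : I.src b ≠ I.dst a := fun h => by rw [h] at hb2; omega
      refine ⟨b, hb1, ?_, ?_, hb4, ?_, hb6⟩
      · simpa [hne] using hb2
      · simpa [hne] using hb3
      · subst hb1
        rw [← hb5]
        simp only [Instance.redCost]; split_ifs <;> omega

lemma raise_exec {ν : Memory} (h : Reads I W z π stamp ν) :
    (raise.exec ν).nodes I 7 = fun v => if stamp v < 1 then π v + ν.var 12 else π v := by
  have := Cmd.loop_induction (i := 9) (b := 0)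
    (c := .ite (.lt (.get 8 (.var 9)) (.lit 1))
      (.store 7 (.var 9) (.add (.get 7 (.var 9)) (.var 12))) skip) (by decide)
    (fun j μ => (∀ v : Fin I.n, μ.arr 7 ((v : ℕ) : ℤ) =
      if (v : ℕ) < j ∧ stamp v < 1 then π v + ν.var 12 else π v) ∧
      (∀ v : Fin I.n, μ.arr 8 ((v : ℕ) : ℤ) = stamp v) ∧ μ.var 12 = ν.var 12)
    h.holds.n ⟨fun v => by simp [← h.π, Memory.nodes], fun v => by simp [← h.stamp, Memory.nodes],
      by simp⟩ ?_
  · funext v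
    have := this.1 v
    simpa [raise, Memory.nodes] using this
  · rintro j hj μ hi - ⟨h1, h2, h3⟩
    have h4 := h2 ⟨j, hj⟩
    have h5 := h1 ⟨j, hj⟩
    simp only at h4 h5
    refine ⟨fun v => ?_, fun v => ?_, ?_⟩
    · have h6 : ((v : ℕ) : ℤ) = j ↔ v = ⟨j, hj⟩ := by rw [Fin.ext_iff]; simp
      have h7 : (v : ℕ) < j + 1 ↔ (v : ℕ) < j ∨ v = ⟨j, hj⟩ := by
        rw [Fin.ext_iff]; simp; omega
      by_cases h8 : stamp ⟨j, hj⟩ < 1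
      · simp only [Cmd.exec, Expr.eval, hi, h4, h8, h3, h5]
        by_cases h9 : v = ⟨j, hj⟩
        · subst h9; simp [h8]
        · simp [h9, h6, h7, h1]
      · simp only [Cmd.exec, Expr.eval, hi, h4, h8, skip]
        by_cases h9 : v = ⟨j, hj⟩
        · subst h9; simp [h8, h5]
        · simp [h9, h7, h1]
    · simp only [Cmd.exec, skip]
      split_ifs <;> simp [h2]
    · simp only [Cmd.exec, skip]
      split_ifs <;> simp [h3]

/-- The state of the search after `r` rounds. -/
def SearchInv (I : Instance kind) (W z : Fin I.m → ℤ) (r : ℕ) (ν : Memory) : Prop :=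
  Holds I W ν ∧ ν.edges I 6 = z ∧
    ((ν.var 6 ≠ 0 ∧ ¬ ∃ S, I.Feasible S) ∨
    (ν.var 6 = 0 ∧ I.Certifies W z (ν.nodes I 7) ∧
      Tree I W z (ν.nodes I 7) (ν.nodes I 8) (ν.nodes I 9) (ν.nodes I 10) (ν.nodes I 11) (r + 1) ∧
      (0 < ν.nodes I 8 I.t ∨
        r + 1 ≤ (Finset.univ.filter fun v => 0 < ν.nodes I 8 v).card)))

lemma SearchInv.setVar {r : ℕ} {ν : Memory} (h : SearchInv I W z r ν) {x : ℕ} {v : ℤ}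
    (hx : x ∉ [0, 1, 3, 4, 6]) : SearchInv I W z r (ν.setVar x v) := by
  refine ⟨h.1.setVar (by revert hx; simp; tauto), h.2.1, ?_⟩
  have h6 : (ν.setVar x v).var 6 = ν.var 6 := by
    rw [Memory.setVar_var, if_neg]; rintro rfl; simp at hx
  rw [h6]
  exact h.2.2

/-- The cut rules out the full edge set, and feasibility is monotone. -/
lemma infeasible_of_no_crossing {j : ℕ} (hz : I.IntFlow z j) (hj : j ≤ I.k)
    (hs : 0 < stamp I.s) (ht : ¬ 0 < stamp I.t) (h : ∀ a, ¬ Crossing I z stamp a) :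
    ¬ ∃ S, I.Feasible S := by
  rintro ⟨S, hS⟩
  refine hz.not_feasible (S := Finset.univ) hj (by simp) (X := {v | 0 < stamp v}) hs ht
    (fun a ha _ hu => ?_) fun F hF hc => ?_
  · by_contra hv
    simp only [Set.mem_ofPred_eq, not_lt] at hu hv
    exact h a ⟨ha, hu, by omega⟩
  · refine Relation.ReflTransGen.mono (r := I.Step (S \ F)) (fun u v => ?_) _ _ (hS F hF hc)
    rintro ⟨e, he, h⟩
    exact ⟨e, by simpa using (Finset.mem_sdiff.1 he).2, h⟩

lemma extend_exec {ν : Memory} {a : Fin I.m × Bool} {r : ℕ} (h8 : ν.var 8 = r)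
    (h13 : ν.var 13 = ((a.1 : ℕ) : ℤ)) (h14 : ν.var 14 = Instance.sgn a.2)
    (h15 : ν.var 15 = ((I.src a : ℕ) : ℤ)) (h16 : ν.var 16 = ((I.dst a : ℕ) : ℤ)) :
    (extend.exec ν).nodes I 7 = ν.nodes I 7 ∧
    ((extend.exec ν).nodes I 8 = fun v => if v = I.dst a then (r : ℤ) + 2 else ν.nodes I 8 v) ∧
    ((extend.exec ν).nodes I 9 =
      fun v => if v = I.dst a then ((a.1 : ℕ) : ℤ) else ν.nodes I 9 v) ∧
    ((extend.exec ν).nodes I 10 =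
      fun v => if v = I.dst a then Instance.sgn a.2 else ν.nodes I 10 v) ∧
    ((extend.exec ν).nodes I 11 =
      fun v => if v = I.dst a then ((I.src a : ℕ) : ℤ) else ν.nodes I 11 v) := by
  refine ⟨?_, ?_, ?_, ?_, ?_⟩ <;> funext v <;>
    simp [Memory.nodes, extend, Cmd.exec, Expr.eval, h8, h13, h14, h15, h16, Fin.val_inj]

lemma nodes_exec {c : Cmd} {a : ℕ} (h : a ∉ c.arrs) (ν : Memory) :
    (c.exec ν).nodes I a = ν.nodes I a := by
  funext v; simp only [Memory.nodes]; rw [Cmd.exec_arr h]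

lemma edges_exec {c : Cmd} {a : ℕ} (h : a ∉ c.arrs) (ν : Memory) :
    (c.exec ν).edges I a = ν.edges I a := by
  funext v; simp only [Memory.edges]; rw [Cmd.exec_arr h]

/-- Until `t` is reached or failure is detected, every round reaches a new node; the cardinality in
`SearchInv` records this progress. -/
lemma round_exec {r j : ℕ} {ν : Memory} (hz : I.IntFlow z j) (hj : j ≤ I.k) (hr : ν.var 8 = r)
    (h : SearchInv I W z r ν) : SearchInv I W z (r + 1) ((searchRound kind).exec ν) := by
  have hH : Holds I W ((searchRound kind).exec ν) :=
    h.1.exec (by cases kind <;> decide) (by cases kind <;> decide)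
  refine ⟨hH, (edges_exec (by cases kind <;> decide) ν).trans h.2.1, ?_⟩
  obtain ⟨hI, hz6, h⟩ := h
  rcases h with ⟨h6, h⟩ | ⟨h6, hc, hT, hcard⟩
  · left
    simp only [searchRound, Cmd.exec, Expr.eval, h6, ne_eq, not_false_eq_true, if_true]
    exact ⟨by simpa [skip, Cmd.exec] using h6, h⟩
  by_cases ht : 0 < ν.nodes I 8 I.t
  · right
    have ht' : 0 < ν.arr 8 ((I.t : ℕ) : ℤ) := ht
    simp only [searchRound, Cmd.exec, Expr.eval, h6, hI.t, ht', ne_eq, not_true_eq_false, if_false,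
      if_true, one_ne_zero, not_false_eq_true, skip, Memory.setVar_var]
    exact ⟨by simp, hc, ⟨hT.start, fun v => (hT.le v).trans (by push_cast; omega),
      hT.parent⟩, Or.inl ht⟩
  have ht' : ¬ 0 < ν.arr 8 ((I.t : ℕ) : ℤ) := ht
  have hR : Reads I W z (ν.nodes I 7) (ν.nodes I 8) ν := ⟨hI, hz6, rfl, rfl⟩
  have hR1 : Reads I W z (ν.nodes I 7) (ν.nodes I 8) ((scan kind).exec ν) :=
    hR.exec (by cases kind <;> decide) (by cases kind <;> decide)
  simp only [searchRound, Cmd.exec, Expr.eval, h6, hI.t, ht', ne_eq, not_true_eq_false, if_false]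
  have h6' : ((scan kind).exec ν).var 6 = 0 := by
    rw [Cmd.exec_var (by cases kind <;> decide), h6]
  have h8' : ((scan kind).exec ν).var 8 = r := by
    rw [Cmd.exec_var (by cases kind <;> decide), hr]
  have h9 : ((scan kind).exec ν).nodes I 9 = ν.nodes I 9 :=
    nodes_exec (by cases kind <;> decide) ν
  have h10 : ((scan kind).exec ν).nodes I 10 = ν.nodes I 10 :=
    nodes_exec (by cases kind <;> decide) ν
  have h11 : ((scan kind).exec ν).nodes I 11 = ν.nodes I 11 :=
    nodes_exec (by cases kind <;> decide) ν
  rcases scan_exec hR (kind := kind) with ⟨hf, hno⟩ | ⟨hf, a, ha, h12, h13, h14, h15, h16, hmin⟩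
  · left
    simp only [hf, not_true_eq_false, if_false]
    refine ⟨by simp, infeasible_of_no_crossing hz hj ?_ ht fun a => hno a trivial⟩
    rw [hT.start]; exact one_pos
  · right
    simp only [hf, not_false_eq_true, if_true]
    generalize (scan kind).exec ν = μ at *
    have hr7 := raise_exec hR1
    rw [h12] at hr7
    have hv : ∀ x, x ≠ 9 ∧ x ≠ 29 → (raise.exec μ).var x = μ.var x := fun x hx =>
      Cmd.exec_var (by simp [raise, skip, Cmd.vars, hx]) μ
    have hn : ∀ a, a ≠ 7 → (raise.exec μ).nodes I a = μ.nodes I a := fun a ha =>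
      nodes_exec (by simp [raise, skip, Cmd.arrs, ha]) μ
    obtain ⟨e7, e8, e9, e10, e11⟩ := extend_exec (I := I) (ν := raise.exec μ) (a := a) (r := r)
      (by rw [hv _ (by decide), h8']) (by rw [hv _ (by decide), h13])
      (by rw [hv _ (by decide), h14]) (by rw [hv _ (by decide), h15])
      (by rw [hv _ (by decide), h16])
    rw [hn _ (by decide), hR1.stamp] at e8
    rw [hn _ (by decide), h9] at e9
    rw [hn _ (by decide), h10] at e10
    rw [hn _ (by decide), h11] at e11
    rw [e7, e8, e9, e10, e11, hr7]
    refine ⟨by rw [Cmd.exec_var (by decide), hv _ (by decide), h6'],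
      Certifies.raise hc ha fun b hb => hmin b trivial hb, ?_, Or.inr ?_⟩
    · have := hT.extend ha
      push_cast
      rw [show (r : ℤ) + 1 + 1 = r + 2 by ring]
      exact this
    · have hd : I.dst a ∉ Finset.univ.filter fun v => 0 < ν.nodes I 8 v := by
        have := ha.2.2
        simp; omega
      have h1 := hcard.resolve_left ht
      rw [← Nat.succ_le_succ_iff, Nat.succ_eq_add_one, Nat.succ_eq_add_one,
        ← Finset.card_insert_of_notMem hd] at h1
      refine h1.trans (Finset.card_le_card fun v hv => ?_)
      simp only [Finset.mem_insert, Finset.mem_filter, Finset.mem_univ, true_and] at hv ⊢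
      split_ifs with h2
      · omega
      · exact hv.resolve_left h2

lemma search_exec {j : ℕ} {ν : Memory} (hI : Holds I W ν) (hz6 : ν.edges I 6 = z)
    (hz : I.IntFlow z j) (hj : j ≤ I.k) (hc : I.Certifies W z (ν.nodes I 7)) (h6 : ν.var 6 = 0) :
    let μ := (search kind).exec ν
    Holds I W μ ∧ μ.edges I 6 = z ∧
    ((μ.var 6 ≠ 0 ∧ ¬ ∃ S, I.Feasible S) ∨
    (μ.var 6 = 0 ∧ I.Certifies W z (μ.nodes I 7) ∧
      Tree I W z (μ.nodes I 7) (μ.nodes I 8) (μ.nodes I 9) (μ.nodes I 10) (μ.nodes I 11)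
        (I.n + 1) ∧ 0 < μ.nodes I 8 I.t)) := by
  have h0 := Cmd.loop_induction (i := 9) (b := 0) (c := .store 8 (.var 9) (.lit 0)) (by decide)
    (fun j μ => ∀ v : Fin I.n, (v : ℕ) < j → μ.arr 8 ((v : ℕ) : ℤ) = 0) hI.n (by simp) (by
      intro j hj μ hi _ h v hv
      simp only [Cmd.exec, Expr.eval, hi, Memory.setVar_arr, Memory.setArr_arr, Nat.cast_inj,
        true_and]
      split_ifs
      · rfl
      · exact h v (by omega))
  have hH1 : Holds I W ((Cmd.loop 9 0 (.store 8 (.var 9) (.lit 0))).exec ν) :=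
    hI.exec (by decide) (by decide)
  have hz1 : ((Cmd.loop 9 0 (.store 8 (.var 9) (.lit 0))).exec ν).edges I 6 = z :=
    (edges_exec (by decide) ν).trans hz6
  have hc1 : I.Certifies W z (((Cmd.loop 9 0 (.store 8 (.var 9) (.lit 0))).exec ν).nodes I 7) := by
    rwa [nodes_exec (by decide) ν]
  have h61 : ((Cmd.loop 9 0 (.store 8 (.var 9) (.lit 0))).exec ν).var 6 = 0 := by
    rw [Cmd.exec_var (by decide), h6]
  -- `Cmd.exec.eq_3` is the equation for `seq`; it leaves the loops folded so that they can be
  -- generalized.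
  simp only [search, Cmd.exec.eq_3]
  generalize (Cmd.loop 9 0 (.store 8 (.var 9) (.lit 0))).exec ν = μ at *
  have h2 : SearchInv I W z 0 ((Cmd.store 8 (.var 3) (.lit 1)).exec μ) := by
    have hn : ∀ v, ((Cmd.store 8 (.var 3) (.lit 1)).exec μ).nodes I 8 v =
        if v = I.s then 1 else 0 := by
      intro v
      simp [Cmd.exec, Expr.eval, Memory.nodes, hH1.s, Fin.val_inj, h0]
    refine ⟨hH1.exec (by decide) (by decide), (edges_exec (by decide) μ).trans hz1,
      Or.inr ⟨by rw [Cmd.exec_var (by decide), h61], by rwa [nodes_exec (by decide)], ?_,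
        Or.inr ?_⟩⟩
    · refine ⟨by simp [hn], fun v => by rw [hn]; split_ifs <;> simp, fun v hv hpos => ?_⟩
      rw [hn, if_neg hv] at hpos
      exact absurd hpos (lt_irrefl _)
    · rw [zero_add, Finset.one_le_card]
      exact ⟨I.s, by simp [hn]⟩
  generalize (Cmd.store 8 (.var 3) (.lit 1)).exec μ = ξ at *
  have h3 := Cmd.loop_induction (i := 8) (b := 0) (c := searchRound kind)
    (by cases kind <;> decide) (SearchInv I W z) h2.1.n (h2.setVar (by decide))
    (fun r _ ρ hr _ h => (round_exec hz hj hr h).setVar (by decide))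
  refine ⟨h3.1, h3.2.1, h3.2.2.imp_right fun h => ⟨h.1, h.2.1, h.2.2.1, h.2.2.2.resolve_right ?_⟩⟩
  -- If `t` were not reached, `n` rounds would have reached `n + 1` nodes.
  have := Finset.card_le_univ
    (Finset.univ.filter fun v => 0 < ((Cmd.loop 8 0 (searchRound kind)).exec ξ).nodes I 8 v)
  simp only [Fintype.card_fin] at this
  omega

/-! ### Augmenting the flow -/

/-- The path has been followed backwards from `t` to the current node, within `i` steps. -/
def BackInv (I : Instance kind) (W z : Fin I.m → ℤ) (π stamp : Fin I.n → ℤ) (i : ℕ)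
    (ν : Memory) : Prop :=
  ∃ v : Fin I.n, ν.var 22 = ((v : ℕ) : ℤ) ∧ 0 < stamp v ∧ (v = I.s ∨ stamp v + i ≤ I.n + 1) ∧
    (∀ u, I.excess (ν.edges I 6) u =
      I.excess z u + ((if u = v then 1 else 0) - if u = I.t then 1 else 0)) ∧
    ∀ e, ν.edges I 6 e = z e ∨
      ((stamp v < stamp (I.tail e) ∨ stamp v < stamp (I.head e)) ∧
        ∃ b, I.Residual z (e, b) ∧ I.redCost W z π (e, b) = 0 ∧
          ν.edges I 6 e = z e + Instance.sgn b)

/-- Stamps fall strictly on the way to `s`. Every edge changed so far has an end of larger stamp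
than the current node, but the tree arc into that node does not; so its edge still carries `z` and
no edge is changed twice. -/
lemma back_exec {pE pD pN : Fin I.n → ℤ} (hT : Tree I W z π stamp pE pD pN (I.n + 1)) {i : ℕ}
    {ν : Memory} (hI : Holds I W ν) (h9 : ν.nodes I 9 = pE) (h10 : ν.nodes I 10 = pD)
    (h11 : ν.nodes I 11 = pN) (h : BackInv I W z π stamp i ν) :
    BackInv I W z π stamp (i + 1) (back.exec ν) := by
  obtain ⟨v, h22, hpos, hle, hex, hed⟩ := h
  by_cases hv : v = I.s
  · refine ⟨v, ?_, hpos, Or.inl hv, ?_⟩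
    · simp [back, skip, Cmd.exec, Expr.eval, h22, hI.s, hv]
    · have : (back.exec ν).edges I 6 = ν.edges I 6 := by
        funext e; simp [back, skip, Cmd.exec, Expr.eval, h22, hI.s, hv, Memory.edges]
      rw [this]; exact ⟨hex, hed⟩
  have hv' : ((v : ℕ) : ℤ) ≠ ((I.s : ℕ) : ℤ) := by simpa [Fin.ext_iff] using hv
  obtain ⟨a, ha1, ha2, ha3, ha4, ha5, ha6, ha7, ha8⟩ := hT.parent v hv hpos
  have hlt : stamp v + i ≤ I.n + 1 := hle.resolve_left hv
  have hends : ¬ (stamp v < stamp (I.tail a.1) ∨ stamp v < stamp (I.head a.1)) := by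
    subst ha1
    obtain ⟨e, b⟩ := a
    cases b <;> simp [Instance.src, Instance.dst] at ha3 ⊢ <;> omega
  have hends' : stamp (I.src a) < stamp (I.tail a.1) ∨ stamp (I.src a) < stamp (I.head a.1) := by
    subst ha1
    obtain ⟨e, b⟩ := a
    cases b <;> simp [Instance.src, Instance.dst] at ha3 ⊢ <;> omega
  have hz : ν.edges I 6 a.1 = z a.1 := (hed a.1).resolve_right fun h => hends h.1
  have g9 : ν.arr 9 ((v : ℕ) : ℤ) = ((a.1 : ℕ) : ℤ) := by rw [← ha6, ← h9]; rfl
  have g10 : ν.arr 10 ((v : ℕ) : ℤ) = Instance.sgn a.2 := by rw [← ha7, ← h10]; rfl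
  have g11 : ν.arr 11 ((v : ℕ) : ℤ) = ((I.src a : ℕ) : ℤ) := by rw [← ha8, ← h11]; rfl
  have hz' : ν.arr 6 ((a.1 : ℕ) : ℤ) = z a.1 := hz
  have hnew : (back.exec ν).edges I 6 =
      fun e => ν.edges I 6 e + if e = a.1 then Instance.sgn a.2 else 0 := by
    funext e
    by_cases he : e = a.1
    · subst he
      simp [back, Cmd.exec, Expr.eval, h22, hI.s, hv', g9, g10, Memory.edges]
    · have : ((e : ℕ) : ℤ) ≠ ((a.1 : ℕ) : ℤ) := by simpa [Fin.ext_iff] using he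
      simp [back, Cmd.exec, Expr.eval, h22, hI.s, hv', g9, g10, Memory.edges, he, this]
  refine ⟨I.src a, ?_, ha2, Or.inr (by push_cast; omega), fun u => ?_, fun e => ?_⟩
  · simp [back, Cmd.exec, Expr.eval, h22, hI.s, hv', g11]
  · rw [hnew, Instance.excess_add, hex, Instance.excess_single, ha1]; ring
  · rw [hnew]
    by_cases he : e = a.1
    · subst he
      exact Or.inr ⟨hends', a.2, ha4, ha5, by simp [hz]⟩
    · simp only [he, if_false, add_zero]
      exact (hed e).imp_right fun h => ⟨h.1.imp ha3.trans ha3.trans, h.2⟩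

lemma augment_exec {pE pD pN : Fin I.n → ℤ} (hT : Tree I W z π stamp pE pD pN (I.n + 1))
    {j : ℕ} {ν : Memory} (hI : Holds I W ν) (h6 : ν.edges I 6 = z) (h9 : ν.nodes I 9 = pE)
    (h10 : ν.nodes I 10 = pD) (h11 : ν.nodes I 11 = pN) (ht : 0 < stamp I.t)
    (hW : ∀ e, 0 ≤ W e) (hz : I.IntFlow z j) (hc : I.Certifies W z π) :
    I.IntFlow ((augment.exec ν).edges I 6) (j + 1) ∧
      I.Certifies W ((augment.exec ν).edges I 6) π := by
  have hI1 : Holds I W (ν.setVar 22 (ν.var 4)) := hI.setVar (by decide)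
  have := Cmd.loop_induction (i := 23) (b := 0) (c := back) (by decide)
    (fun i μ => Holds I W μ ∧ μ.nodes I 9 = pE ∧ μ.nodes I 10 = pD ∧ μ.nodes I 11 = pN ∧
      BackInv I W z π stamp i μ) hI1.n
    ⟨hI1.setVar (by decide), h9, h10, h11, I.t, by simp [hI.t], ht,
      Or.inr (by simpa using hT.le I.t), fun u => by
        rw [show ((ν.setVar 22 (ν.var 4)).setVar 23 0).edges I 6 = z from h6]; simp,
      fun e => Or.inl (by rw [← h6]; rfl)⟩ ?_
  · change I.IntFlow (((Cmd.loop 23 0 back).exec (ν.setVar 22 (ν.var 4))).edges I 6) (j + 1) ∧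
      I.Certifies W (((Cmd.loop 23 0 back).exec (ν.setVar 22 (ν.var 4))).edges I 6) π
    obtain ⟨-, -, -, -, v, -, hpos, hle, hex, hed⟩ := this
    have hv : v = I.s := by
      rcases hle with h | h
      · exact h
      · by_contra hv
        -- After `n` steps the stamp is at most 1, whereas a reached node other than `s` has a
        -- parent with a smaller positive stamp.
        obtain ⟨a, -, h1, h2, -⟩ := hT.parent v hv hpos
        omega
    subst hv
    refine ⟨hz.push (fun e => (hed e).imp_right ?_) hex, hc.push hW fun e => (hed e).imp_right ?_⟩
    · rintro ⟨-, b, h1, -, h2⟩; exact ⟨b, h1, h2⟩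
    · rintro ⟨-, b, h1, h2, h3⟩; exact ⟨b, h1, h2, h3⟩
  · rintro i hi μ - - ⟨k1, k9, k10, k11, hb⟩
    refine ⟨(k1.exec (c := back) (by decide) (by decide)).setVar (by decide),
      (nodes_exec (c := back) (by decide) μ).trans k9,
      (nodes_exec (c := back) (by decide) μ).trans k10,
      (nodes_exec (c := back) (by decide) μ).trans k11, ?_⟩
    obtain ⟨v, h22, h⟩ := back_exec hT k1 k9 k10 k11 hb
    exact ⟨v, by simpa using h22, h⟩

/-- The state of the algorithm after `j` augmentations. -/
def FlowInv (I : Instance kind) (W : Fin I.m → ℤ) (j : ℕ) (ν : Memory) : Prop :=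
  Holds I W ν ∧ ((ν.var 6 ≠ 0 ∧ ¬ ∃ S, I.Feasible S) ∨
    (ν.var 6 = 0 ∧ I.IntFlow (ν.edges I 6) j ∧ I.Certifies W (ν.edges I 6) (ν.nodes I 7)))

lemma FlowInv.setVar {j : ℕ} {ν : Memory} (h : FlowInv I W j ν) {x : ℕ} {v : ℤ}
    (hx : x ∉ [0, 1, 3, 4, 6]) : FlowInv I W j (ν.setVar x v) := by
  refine ⟨h.1.setVar (by revert hx; simp; tauto), ?_⟩
  have h6 : (ν.setVar x v).var 6 = ν.var 6 := by
    rw [Memory.setVar_var, if_neg]; rintro rfl; simp at hx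
  rw [h6]
  exact h.2

lemma iteration_exec {j : ℕ} {ν : Memory} (hW : ∀ e, 0 ≤ W e) (hj : j ≤ I.k)
    (h : FlowInv I W j ν) : FlowInv I W (j + 1) ((iteration kind).exec ν) := by
  refine ⟨h.1.exec (by cases kind <;> decide) (by cases kind <;> decide), ?_⟩
  obtain ⟨hI, h⟩ := h
  rcases h with ⟨h6, h⟩ | ⟨h6, hz, hc⟩
  · left
    simp only [iteration, Cmd.exec, Expr.eval, h6, ne_eq, not_false_eq_true, if_true]
    exact ⟨by simpa [skip, Cmd.exec] using h6, h⟩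
  · obtain ⟨k1, k2, k3⟩ := search_exec (kind := kind) hI rfl hz hj hc h6
    simp only [iteration, Cmd.exec, Expr.eval, h6, ne_eq, not_true_eq_false, if_false]
    rcases k3 with ⟨k3, k4⟩ | ⟨k3, k4, k5, k6⟩
    · left
      simp only [k3, not_false_eq_true, if_true]
      exact ⟨by simpa [skip, Cmd.exec] using k3, k4⟩
    · right
      simp only [k3, not_true_eq_false, if_false]
      have := augment_exec k5 k1 k2 rfl rfl rfl k6 hW hz k4
      rw [nodes_exec (c := augment) (by decide), Cmd.exec_var (c := augment) (by decide)]
      exact ⟨k3, this⟩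

/-- `N` may be smaller than `k + 1`: getting stuck at any value `j ≤ k` already proves
infeasibility. -/
lemma flow_exec {N : ℕ} {ν : Memory} (hW : ∀ e, 0 ≤ W e) (hN : N ≤ I.k + 1) (hI : Holds I W ν)
    (h5 : ν.var 5 = N) (h6 : ν.var 6 = 0) (hz : ν.edges I 6 = fun _ => 0)
    (hp : ν.nodes I 7 = fun _ => 0) :
    (((flow kind).exec ν).var 0 = 0 ∧ ¬ ∃ S, I.Feasible S) ∨
    (∃ z π, I.IntFlow z N ∧ I.Certifies W z π ∧
      I.Returns ((flow kind).exec ν) (I.support z)) := by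
  have h0 : FlowInv I W 0 ν := by
    refine ⟨hI, Or.inr ⟨h6, ?_, ?_⟩⟩
    · rw [hz]; exact ⟨by simp, by simp, by simp, by simp [Instance.excess]⟩
    -- For the zero flow and the zero potential the reduced costs are the nonnegative weights.
    · rw [hz, hp]; rintro ⟨e, b⟩ -
      simpa [Instance.redCost, Instance.arcCost, Instance.along] using hW e
  have h := Cmd.loop_induction (i := 7) (b := 5) (c := iteration kind)
    (by cases kind <;> decide) (FlowInv I W) h5
    (h0.setVar (by decide)) fun j hj μ _ _ hμ =>
      (iteration_exec hW (by omega) hμ).setVar (by decide)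
  change (((output).exec ((Cmd.loop 7 5 (iteration kind)).exec ν)).var 0 = 0 ∧ _) ∨
    ∃ z π, I.IntFlow z N ∧ I.Certifies W z π ∧
      I.Returns (output.exec ((Cmd.loop 7 5 (iteration kind)).exec ν)) (I.support z)
  generalize (Cmd.loop 7 5 (iteration kind)).exec ν = μ at *
  obtain ⟨hI', h⟩ := h
  have hvar : (output.exec μ).var 0 = if μ.var 6 = 0 then 1 else 0 := by
    have : ((Cmd.loop 27 1 (.store 0 (.var 27) (.eq (.eq (.get 6 (.var 27)) (.lit 0))
      (.lit 0)))).exec μ).var 6 = μ.var 6 := Cmd.exec_var (by decide) μ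
    rw [← this]
    change (Memory.setVar _ 0 _).var 0 = _
    simp only [Expr.eval, Memory.setVar_var, if_true]
    rfl
  rcases h with ⟨h, h'⟩ | ⟨h, hz, hc⟩
  · exact Or.inl ⟨by rw [hvar, if_neg h], h'⟩
  · refine Or.inr ⟨_, _, hz, hc, by rw [hvar, if_pos h], fun e => ?_⟩
    have := Cmd.loop_induction (i := 27) (b := 1) (c := .store 0 (.var 27)
      (.eq (.eq (.get 6 (.var 27)) (.lit 0)) (.lit 0))) (by decide)
      (fun j ξ => (∀ e : Fin I.m, ξ.edges I 6 e = μ.edges I 6 e) ∧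
        ∀ e : Fin I.m, (e : ℕ) < j → ξ.arr 0 ((e : ℕ) : ℤ) = if μ.edges I 6 e ≠ 0 then 1 else 0)
      hI'.m ⟨fun e => rfl, by simp⟩ (by
        rintro j hj ξ hi - ⟨h1, h2⟩
        refine ⟨fun e => by simpa [Cmd.exec, Memory.edges] using h1 e, fun e he => ?_⟩
        simp only [Cmd.exec, Expr.eval, hi, Memory.setVar_arr, Memory.setArr_arr, Nat.cast_inj,
          true_and]
        by_cases hej : (e : ℕ) = j
        · have := h1 e
          simp only [Memory.edges, hej] at this
          simp only [hej, if_true, this, Memory.edges]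
          split_ifs <;> simp_all
        · rw [if_neg hej]; exact h2 e (by omega))
    have h1 := this.2 e e.2
    change ((Cmd.loop 27 1 _).exec μ).arr 0 _ = _
    rw [h1]
    simp [Instance.support]

/-! ### Integral weights -/

lemma size_mul_le (a b : ℕ) : Nat.size (a * b) ≤ Nat.size a + Nat.size b := by
  rw [Nat.size_le, pow_add]
  exact Nat.mul_lt_mul'' (Nat.lt_size_self a) (Nat.lt_size_self b)

/-- Subadditivity of the bit length keeps every intermediate product within the input size. -/
lemma size_mul_prod_le {ι : Type*} (c : ℕ) (f : ι → ℕ) (s : Finset ι) :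
    Nat.size (c * ∏ i ∈ s, f i) ≤ Nat.size c + ∑ i ∈ s, Nat.size (f i) := by
  classical
  induction s using Finset.induction_on with
  | empty => simp
  | insert i s hi ih =>
    rw [Finset.prod_insert hi, Finset.sum_insert hi, ← mul_assoc, mul_right_comm]
    have := size_mul_le (c * ∏ i ∈ s, f i) (f i)
    omega

/-- The product of the numerator of an edge with the denominators of the other edges among the
first `j` edges. -/
def partialWeight (I : Instance kind) (e : Fin I.m) (j : ℕ) : ℕ :=
  (I.w e).num * ∏ f ∈ Finset.univ.filter (fun f : Fin I.m => (f : ℕ) < j ∧ f ≠ e), (I.w f).den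

lemma partialWeight_succ (e f : Fin I.m) :
    partialWeight I e (f + 1) =
      if e = f then partialWeight I e f else partialWeight I e f * (I.w f).den := by
  have h : ∀ g : Fin I.m, (g : ℕ) < f + 1 ↔ (g : ℕ) < f ∨ g = f := fun g => by
    rw [Fin.ext_iff]; omega
  unfold partialWeight
  split_ifs with hef
  · subst hef
    congr 2
    ext g
    simp only [Finset.mem_filter, Finset.mem_univ, true_and, h]
    tauto
  · rw [mul_assoc, mul_comm (∏ f ∈ _, _), ← Finset.prod_insert (f := fun g => (I.w g).den) (by simp)]
    congr 2
    ext g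
    simp only [Finset.mem_filter, Finset.mem_univ, true_and, h, Finset.mem_insert]
    by_cases hg : g = f
    · subst hg; simp [Ne.symm hef]
    · simp [hg]

lemma size_den_le (f : Fin I.m) : Nat.size (I.w f).den ≤ I.size := by
  have := Finset.single_le_sum (f := fun e => Nat.size (I.w e).num + Nat.size (I.w e).den)
    (fun _ _ => Nat.zero_le _) (Finset.mem_univ f)
  simp only [Instance.size] at this ⊢
  omega

lemma size_partialWeight_le (e : Fin I.m) (j : ℕ) :
    Nat.size (partialWeight I e j) ≤ I.size := by
  have h1 := size_mul_prod_le (I.w e).num (fun f => (I.w f).den)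
    (Finset.univ.filter fun f : Fin I.m => (f : ℕ) < j ∧ f ≠ e)
  have h2 : ∑ f ∈ Finset.univ.filter (fun f : Fin I.m => (f : ℕ) < j ∧ f ≠ e), Nat.size (I.w f).den ≤ ∑ f, Nat.size (I.w f).den :=
    Finset.sum_le_sum_of_subset (Finset.filter_subset _ _)
  have h3 := Finset.single_le_sum (f := fun e => Nat.size (I.w e).num)
    (fun _ _ => Nat.zero_le _) (Finset.mem_univ e)
  simp only [Instance.size, Finset.sum_add_distrib, partialWeight] at *
  omega

/-- The integral weight of an edge. -/
def intWeight (I : Instance kind) (e : Fin I.m) : ℤ := (partialWeight I e I.m : ℕ)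

/-- All weights are scaled by the same positive factor, so the minimum cost flows do not change. -/
lemma intWeight_eq (e : Fin I.m) :
    (intWeight I e : ℚ) = ((∏ f, (I.w f).den : ℕ) : ℚ) * (I.w e : ℚ) := by
  have h1 : (I.w e : ℚ) = ((I.w e).num : ℚ) / ((I.w e).den : ℚ) := by
    have := congrArg (NNRat.cast : ℚ≥0 → ℚ) (NNRat.num_div_den (I.w e)).symm
    push_cast at this
    exact this
  have h2 : ((I.w e).den : ℚ) ≠ 0 := by exact_mod_cast (I.w e).den_ne_zero
  have h3 : (Finset.univ.filter fun f : Fin I.m => (f : ℕ) < I.m ∧ f ≠ e) =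
      Finset.univ.erase e := by
    ext f; simp
  rw [h1, ← Finset.mul_prod_erase _ _ (Finset.mem_univ e), intWeight, partialWeight, h3]
  push_cast
  field_simp

/-- The parts of the memory that the integral weights depend on. -/
structure HoldsWeights (I : Instance kind) (ν : Memory) : Prop where
  m : ν.var 1 = I.m
  num : ∀ e : Fin I.m, ν.arr 2 ((e : ℕ) : ℤ) = (I.w e).num
  den : ∀ e : Fin I.m, ν.arr 3 ((e : ℕ) : ℤ) = (I.w e).den

lemma HoldsWeights.exec {c : Cmd} {ν : Memory} (h : HoldsWeights I ν) (h1 : 1 ∉ c.vars)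
    (h2 : 2 ∉ c.arrs) (h3 : 3 ∉ c.arrs) : HoldsWeights I (c.exec ν) :=
  ⟨by rw [Cmd.exec_var h1, h.m], by rw [Cmd.exec_arr h2]; exact h.num,
    by rw [Cmd.exec_arr h3]; exact h.den⟩

lemma HoldsWeights.setVar {ν : Memory} (h : HoldsWeights I ν) {x : ℕ} {v : ℤ} (hx : x ≠ 1) :
    HoldsWeights I (ν.setVar x v) :=
  ⟨by rw [Memory.setVar_var, if_neg hx.symm, h.m], h.num, h.den⟩

/-- The state of the multiplication loop of the edge `e` after `j` steps. -/
def MultiplyInv (I : Instance kind) (e : Fin I.m) (j : ℕ) (ν : Memory) : Prop :=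
  HoldsWeights I ν ∧ ν.var 24 = ((e : ℕ) : ℤ) ∧ ν.var 26 = (partialWeight I e j : ℕ)

lemma MultiplyInv.step {e : Fin I.m} {j : ℕ} (hj : j < I.m) {ν : Memory} (hi : ν.var 25 = j)
    (h : MultiplyInv I e j ν) :
    MultiplyInv I e (j + 1) (((Cmd.ite (.eq (.var 24) (.var 25)) skip
      (.assign 26 (.mul (.var 26) (.get 3 (.var 25))))).exec ν).setVar 25 (j + 1)) := by
  obtain ⟨h1, h2, h3⟩ := h
  refine ⟨(h1.exec (by decide) (by decide) (by decide)).setVar (by decide), ?_, ?_⟩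
  · rw [Memory.setVar_var, if_neg (by decide), Cmd.exec_var (by decide), h2]
  · have h4 := partialWeight_succ e ⟨j, hj⟩
    have h5 := h1.den ⟨j, hj⟩
    simp only at h4 h5
    rw [h4]
    by_cases he : e = ⟨j, hj⟩
    · subst he
      simp [Cmd.exec, Expr.eval, h2, h3, hi, skip]
    · have : ((e : ℕ) : ℤ) ≠ j := by simpa [Fin.ext_iff] using he
      simp [Cmd.exec, Expr.eval, h2, h3, hi, h5, he, this]

/-- The cost of a multiplication depends on its factors, so the time bound needs the same invariant
as correctness. -/
lemma multiply_exec {e : Fin I.m} {ν : Memory} (h : HoldsWeights I ν)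
    (h24 : ν.var 24 = ((e : ℕ) : ℤ)) (h26 : ν.var 26 = (I.w e).num) :
    MultiplyInv I e I.m (multiply.exec ν) ∧ multiply.Tame I.size (I.size + 1) ν := by
  have h0 : MultiplyInv I e 0 (ν.setVar 25 0) :=
    ⟨h.setVar (by decide), by simpa using h24, by simpa [partialWeight] using h26⟩
  refine ⟨Cmd.loop_induction (by decide) (MultiplyInv I e) h.m h0
      fun j hj μ hi _ hμ => hμ.step hj hi,
    Cmd.tame_loop (by decide) (MultiplyInv I e) h.m (by simp only [Instance.size]; omega) h0
      (fun j hj μ hi _ hμ => hμ.step hj hi) fun j hj μ hi _ hμ => ?_⟩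
  refine ⟨⟨trivial, trivial⟩, fun _ => trivial, fun _ => ⟨⟨?_, ?_⟩, trivial, trivial⟩⟩
  · simpa [Expr.eval, hμ.2.2, bitLength] using size_partialWeight_le e j
  · have := hμ.1.den ⟨j, hj⟩
    simp only at this
    simpa [Expr.eval, hi, this, bitLength] using size_den_le (I := I) ⟨j, hj⟩

lemma weights_exec {ν : Memory} (h : HoldsWeights I ν) :
    (∀ e, (weights.exec ν).edges I 5 e = intWeight I e) ∧
      weights.Tame I.size (I.size + 1) ν := by
  let Inv : ℕ → Memory → Prop := fun j μ => HoldsWeights I μ ∧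
    ∀ e : Fin I.m, (e : ℕ) < j → μ.arr 5 ((e : ℕ) : ℤ) = intWeight I e
  have h0 : Inv 0 (ν.setVar 24 0) := ⟨h.setVar (by decide), by simp⟩
  have hm : ∀ (j : ℕ) (hj : j < I.m) (μ : Memory), μ.var 24 = j → HoldsWeights I μ →
      MultiplyInv I ⟨j, hj⟩ I.m (multiply.exec ((Cmd.assign 26 (.get 2 (.var 24))).exec μ)) ∧
        multiply.Tame I.size (I.size + 1) ((Cmd.assign 26 (.get 2 (.var 24))).exec μ) := by
    intro j hj μ hi hμ
    refine multiply_exec (hμ.setVar (by decide)) (by simpa [Cmd.exec] using hi) ?_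
    simpa [Cmd.exec, Expr.eval, hi] using hμ.num ⟨j, hj⟩
  have hstep : ∀ j < I.m, ∀ μ, μ.var 24 = (j : ℤ) → μ.var 1 = (I.m : ℤ) → Inv j μ →
      Inv (j + 1) (((Cmd.seq (.assign 26 (.get 2 (.var 24)))
        (.seq multiply (.store 5 (.var 24) (.var 26)))).exec μ).setVar 24 (j + 1)) := by
    rintro j hj μ hi - ⟨h1, h2⟩
    obtain ⟨⟨h3, h4, h5⟩, -⟩ := hm j hj μ hi h1
    refine ⟨(h1.exec (by decide) (by decide) (by decide)).setVar (by decide), fun e he => ?_⟩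
    simp only [Memory.setVar_arr, Cmd.exec.eq_3]
    generalize hξ : multiply.exec ((Cmd.assign 26 (.get 2 (.var 24))).exec μ) = ξ at *
    have ha : ξ.arr 5 = μ.arr 5 := by
      rw [← hξ, Cmd.exec_arr (by decide), Cmd.exec_arr (by decide)]
    simp only [Cmd.exec, Expr.eval, Memory.setArr_arr, h4, h5, ha, Nat.cast_inj, true_and]
    split_ifs with hej
    · have : e = ⟨j, hj⟩ := Fin.ext hej
      rw [this, intWeight]
    · exact h2 e (by omega)
  refine ⟨fun e => (Cmd.loop_induction (by decide) Inv h.m h0 hstep).2 e e.2,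
    Cmd.tame_loop (by decide) Inv h.m (by simp only [Instance.size]; omega) h0 hstep ?_⟩
  rintro j hj μ hi - ⟨h1, -⟩
  exact ⟨trivial, (hm j hj μ hi h1).2, trivial, trivial⟩

/-! ### The main result -/

/-- The number of augmentations. -/
def augmentations (I : Instance kind) : ℕ := min I.m I.k + 1

lemma edgeArray_apply (f : Fin I.m → ℤ) (e : Fin I.m) : I.edgeArray f ((e : ℕ) : ℤ) = f e := by
  simp [Instance.edgeArray]

lemma holds_before_flow :
    let ν := setValue.exec (weights.exec I.input)
    Holds I (intWeight I) ν ∧ ν.var 5 = augmentations I ∧ ν.var 6 = 0 ∧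
      (ν.edges I 6 = fun _ => 0) ∧ (ν.nodes I 7 = fun _ => 0) ∧
      weights.Tame I.size (I.size + 1) I.input := by
  obtain ⟨hW, ht⟩ := weights_exec (I := I) (ν := I.input)
    ⟨rfl, edgeArray_apply fun e => ((I.w e).num : ℤ), edgeArray_apply fun e => ((I.w e).den : ℤ)⟩
  have hv : ∀ x ∈ [0, 1, 2, 3, 4, 6], (weights.exec I.input).var x = I.input.var x :=
    fun x hx => Cmd.exec_var (by revert x hx; decide) _
  have ha : ∀ a ∈ [0, 1, 4, 6, 7], (weights.exec I.input).arr a = I.input.arr a :=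
    fun a ha => Cmd.exec_arr (by revert a ha; decide) _
  have hH : Holds I (intWeight I) (weights.exec I.input) :=
    ⟨hv 0 (by decide), hv 1 (by decide), hv 3 (by decide), hv 4 (by decide),
      by rw [ha 0 (by decide)]; exact edgeArray_apply fun e => ((I.tail e : ℕ) : ℤ),
      by rw [ha 1 (by decide)]; exact edgeArray_apply fun e => ((I.head e : ℕ) : ℤ),
      by rw [ha 4 (by decide)]; exact edgeArray_apply fun e => if e ∈ I.faulty then 1 else 0, hW⟩
  refine ⟨hH.exec (by decide) (by decide), ?_, ?_, ?_, ?_, ht⟩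
  · have h1 := hH.m
    have h2 : (weights.exec I.input).var 2 = I.k := hv 2 (by decide)
    simp only [setValue, Cmd.exec, Expr.eval, h1, h2, augmentations]
    split_ifs with h <;> simp_all; omega
  · rw [Cmd.exec_var (by decide), hv 6 (by decide)]; rfl
  · rw [edges_exec (by decide)]; funext e; simp only [Memory.edges, ha 6 (by decide)]; rfl
  · rw [nodes_exec (by decide)]; funext e; simp only [Memory.nodes, ha 7 (by decide)]; rfl

/-- `tame_of_mulFree` needs unwritten loop bounds. Hence `setValue`, which writes variable `5`, and
`output`, which writes variable `0`, are treated apart from the main loop. -/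
lemma algorithm_tame : (algorithm kind).Tame I.size (I.size + 1) I.input := by
  obtain ⟨hH, h5, -, -, -, ht⟩ := holds_before_flow (I := I)
  refine ⟨ht, Cmd.tame_of_mulFree (by decide) (by simp [setValue, Cmd.bounds]), ?_⟩
  generalize setValue.exec (weights.exec I.input) = ν at *
  have hn : (ν.var 0).toNat ≤ I.size + 1 := by
    rw [hH.n]; simp only [Instance.size, Int.toNat_natCast]; omega
  have hm : (ν.var 1).toNat ≤ I.size + 1 := by
    rw [hH.m]; simp only [Instance.size, Int.toNat_natCast]; omega
  have hN : (ν.var 5).toNat ≤ I.size + 1 := by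
    rw [h5]; simp only [Instance.size, augmentations, Int.toNat_natCast]; omega
  constructor
  · refine Cmd.tame_of_mulFree (by cases kind <;> decide) fun b hb => ?_
    have : b ∉ (Cmd.loop 7 5 (iteration kind)).vars ∧ (b = 0 ∨ b = 1 ∨ b = 5) := by
      revert b; cases kind <;> decide
    refine ⟨this.1, ?_⟩
    rcases this.2 with rfl | rfl | rfl <;> assumption
  · refine Cmd.tame_of_mulFree (by decide) fun b hb => ?_
    have : b ∉ output.vars ∧ b = 1 := by revert b; decide
    refine ⟨this.1, ?_⟩
    rw [this.2, Cmd.exec_var (by cases kind <;> decide)]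
    exact hm

lemma algorithm_exec :
    (I.ReportsInfeasible ((algorithm kind).exec I.input) ∧ ¬ ∃ S, I.Feasible S) ∨
    ∃ z, I.IntFlow z (I.k + 1) ∧ I.IsIntegralMinCostFlow z ∧
      I.Returns ((algorithm kind).exec I.input) (I.support z) := by
  obtain ⟨hH, h5, h6, hz, hp, -⟩ := holds_before_flow (I := I)
  have hL : 0 < ∏ f, (I.w f).den := Finset.prod_pos fun f _ => (I.w f).den_pos
  have hW : ∀ e, 0 ≤ intWeight I e := fun e => Int.natCast_nonneg _
  have hle : augmentations I ≤ I.k + 1 := by simp only [augmentations]; omega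
  rcases flow_exec (kind := kind) hW hle hH h5 h6 hz hp with h | ⟨z, π, h1, h2, h3⟩
  · exact Or.inl h
  · right
    -- For `m ≤ k` the machine never computes the flow `y` of value `k + 1`; it outputs the support
    -- of `z`, which is the same set.
    by_cases hmk : I.m ≤ I.k
    · rw [augmentations, min_eq_left hmk] at h1
      obtain ⟨y, hy1, hy2, hy3⟩ := Instance.Certifies.extend hmk h1 h2
      exact ⟨y, hy1, hy2.isIntegralMinCostFlow hL intWeight_eq hy1, by rw [hy3]; exact h3⟩
    · rw [augmentations, min_eq_right (by omega)] at h1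
      exact ⟨z, h1, h2.isIntegralMinCostFlow hL intWeight_eq h1, h3⟩

end FaultTolerantPath

theorem corollary5 (kind : FaultTolerantPath.GraphKind) :
    ∃ (P : FaultTolerantPath.Prog) (p : Polynomial ℕ),
      ∀ I : FaultTolerantPath.Instance kind,
        ∃ (T : ℕ) (ν : FaultTolerantPath.Memory),
          FaultTolerantPath.Runs P I.input T ν ∧ T ≤ p.eval I.size ∧
          ((∃ S, I.Feasible S) →
            ∃ S : Finset (Fin I.m), I.Returns ν S ∧
              I.IsApproxSolution ((I.k : ℚ≥0) + 1) S ∧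
              ∃ z : Fin I.m → ℤ, I.IsIntegralMinCostFlow z ∧ S = I.support z) ∧
          ((¬ ∃ S, I.Feasible S) → I.ReportsInfeasible ν) := by
  -- The bound of `runs_toProg` with `β = I.size` and `B = I.size + 1`, which covers nodes, edges
  -- and the `min m k + 1` augmentations.
  refine ⟨(FaultTolerantPath.Program.algorithm kind).toProg,
    Polynomial.C (FaultTolerantPath.Program.algorithm kind).length *
      (2 * Polynomial.X + 1) *
      (Polynomial.X + 1 + 1) ^ (FaultTolerantPath.Program.algorithm kind).depth, fun I => ?_⟩
  obtain ⟨T, hT, hr⟩ := FaultTolerantPath.Cmd.runs_toProg (by cases kind <;> decide)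
    (FaultTolerantPath.algorithm_tame (I := I))
  refine ⟨T, _, hr, by simpa using hT, ?_, ?_⟩
  · intro hS
    rcases FaultTolerantPath.algorithm_exec (I := I) with h | ⟨z, h1, h2, h3⟩
    · exact absurd hS h.2
    · exact ⟨_, h3, h2.isApproxSolution h1, z, h2, rfl⟩
  · intro hS
    rcases FaultTolerantPath.algorithm_exec (I := I) with h | ⟨z, h1, h2, h3⟩
    · exact h.1
    · exact absurd ⟨_, h1.feasible_support⟩ hS
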